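/- **Setting.** Let $\Lambda$ be the vertex set of a finite connected graph with graph distance $\mathsf d$, and let site $i$ carry a qudit of finite dimension $q_i$. A set $S\subset\Lambda$ is *connected* if it is non-empty and any two of its sites are joined by a path inside $S$; $\mathrm{diam}\,S=\max_{i,j\in S}\mathsf d(i,j)$, $S^{\rm c}=\Lambda\setminus S$, and $\partial S$ is the set of sites of $S$ adjacent to $S^{\rm c}$. Fix an integer $d\ge1$ and constants $c_d,c_d'>0$, and assume $|S|\le c_d\max(1,\mathrm{diam}\,S)^d$ for every connected $S$. *Commuting Hamiltonian.* Let $H_0'=\sum_f\lambda_f(1-P_f)$ be a finite sum over factors $f$, where the $P_f$ are pairwise commuting orthogonal projectors, $P_f$ is supported on a connected set (also denoted $f$) of diameter at most $\ell_0$ (several factors may have the same support), $\lambda_f\ge\Delta'>0$, and $\prod_fP_f\ne0$. For $F\subset\Lambda$ put $P_F=\prod_{f\subset F}P_f$. Let $|\psi_0\rangle$ be a normalized state with $P_\Lambda|\psi_0\rangle=|\psi_0\rangle$. *Syndromes and local norms.* An operator has syndrome $\mathbf s$ (a set of factors) if it anticommutes with $2P_f-1$ for all $f\in\mathbf s$ and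 commutes with $2P_f-1$ for all $f\notin\mathbf s$. A local decomposition of $\mathcal O$ is a representation $\mathcal O=\sum_{S,\mathbf s}\mathcal O_{S,\mathbf s}$ over connected $S$ and sets $\mathbf s$ of factors contained in $S$, where $\mathcal O_{S,\mathbf s}$ is supported in $S$ and has syndrome $\mathbf s$. Its volume-local norm is $\|\mathcal O\|_K=\max_{i\in\Lambda}\sum_{S\ni i,\mathbf s}e^{K|S|}\|\mathcal O_{S,\mathbf s}\|$. *Local nondegeneracy.* $|\psi_0\rangle$ is $R'$-locally nondegenerate if for every connected $S$ with $|S|\le c_d(R')^d$, every $\mathcal O$ supported in $S$ with a syndrome $\mathbf s$ consisting of factors contained in $S$, and every $F\subset S$ such that all $f\in\mathbf s$ intersect $F$ and every connected component of $S\setminus F$ is adjacent to $S^{\rm c}$, there is an operator $\widetilde{\mathcal O}$ supported in $F$, with syndrome $\mathbf s$ and $\|\widetilde{\mathcal O}\|\le\|\mathcal O\|$, such that $\mathcal O|\psi_0\rangle=\widetilde{\mathcal O}|\psi_0\rangle$. *Local diagonalizability.* For Hermitian $H_0,V$, the triple $(H_0,V,|\psi_0\rangle)$ is $(v_*,\mathbb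 d_*,a_*,K_*)$-locally-diagonalizable if there are anti-Hermitian $A(s)$, $s\in[0,1]$, with local decompositions depending integrably on $s$ and $\|A(s)\|_{K_*}\le a_*$, and Hermitian $H_*,V_*$, such that with $U=\mathcal T e^{\int_0^1A(s)\,ds}$ one has $U^\dagger(H_0+V)U=H_*+V_*$, $H_*|\psi_0\rangle=E_*|\psi_0\rangle$ for some $E_*\in\mathbb R$, and $H_*+V_*-H_0$ and $V_*$ have local decompositions with $\|H_*+V_*-H_0\|_{K_*}\le\mathbb d_*$ and $\|V_*\|_0\le v_*$. **Theorem.** Let $d\ge 1$, $c_d,c_d'>0$, $\ell_0,\ell_D'\in\mathbb N$ and $0<K_1\le1$. There are constants $c_{\rm R},c_V,c_*>0$, depending only on $d,c_d,c_d',\ell_0,\ell_D',K_1$, such that the following holds in the setting above. Let $|\psi_0\rangle$ be $R'$-locally nondegenerate, and assume the isoperimetric inequality $|\partial S|\ge c_d'|S|^{1-1/d}$ for every non-empty $S\subset\Lambda$ with $|S|\le c_d(R')^d$ (in particular $|\Lambda|>c_d(R')^d$). Let $D'$ be Hermitian with a local decomposition such that $D'_{S,\mathbf s}=0$ unless $\mathrm{diam}\,S\le\ell_D'$,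 $[D'_{S,\mathbf s},P_S]=0$ for all $S,\mathbf s$ ("locally block-diagonal"), and $\|D'\|_0\le\mathbb d'$ with $\mathbb d'>0$. Let $V_1$ be Hermitian with a local decomposition such that $\|V_1\|_{K_1}\le\epsilon$. Suppose $\max(\mathbb d',\epsilon)\le c_V\Delta'$, put $R=c_{\rm R}\Delta'/\mathbb d'$, and suppose $R<R'$. Then, with $H_0=H_0'+D'$, the triple $(H_0,V_1,|\psi_0\rangle)$ is $(v_*,\mathbb d_*,a_*,K_1/6)$-locally-diagonalizable, where $$v_*=\epsilon\,2^{2-k_*},\qquad \mathbb d_*=4\epsilon,\qquad a_*=\frac{2\epsilon}{\Delta'},\qquad k_*=\left\lfloor c_*\min\left(\frac{\Delta'/\epsilon}{\ln^2(\Delta'/\epsilon)},\,R^d\right)\right\rfloor$$ (for $\epsilon=0$, all of $v_*,\mathbb d_*,a_*$ are $0$). -/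

import Mathlib

open scoped Matrix.Norms.L2Operator

noncomputable section

namespace FalseVacuum

/-! ### Geometry of the interaction graph -/

section Geometry

variable {Λ : Type*}

/-- A set of sites is connected when any two of its sites are joined by a path inside the set.
Connected sets are non-empty. -/
def ConnectedSet (G : SimpleGraph Λ) (S : Finset Λ) : Prop :=
  (G.induce (S : Set Λ)).Connected

/-- The largest graph distance between two sites of `S`. -/
def diam (G : SimpleGraph Λ) (S : Finset Λ) : ℕ :=
  S.sup fun i => S.sup fun j => G.dist i j

open Classical in
/-- The sites of `S` at distance one from the complement of `S`. -/
def boundary (G : SimpleGraph Λ) (S : Finset Λ) : Finset Λ :=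
  S.filter fun i => ∃ j, j ∉ S ∧ G.Adj i j

/-- Volume growth of a `d`-dimensional graph with constant `cd`. -/
def VolumeGrowth (G : SimpleGraph Λ) (d : ℕ) (cd : ℝ) : Prop :=
  ∀ S : Finset Λ, ConnectedSet G S →
    (S.card : ℝ) ≤ cd * (max 1 (diam G S : ℝ)) ^ d

/-- The `d`-dimensional isoperimetric inequality with constant `cd'`, for sets of at most
`M` sites. -/
def Isoperimetric (G : SimpleGraph Λ) (d : ℕ) (cd' M : ℝ) : Prop :=
  ∀ S : Finset Λ, S.Nonempty → (S.card : ℝ) ≤ M →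
    cd' * (S.card : ℝ) ^ (1 - 1 / (d : ℝ)) ≤ ((boundary G S).card : ℝ)

end Geometry

/-! ### Qudits and operators -/

section Operators

variable {Λ : Type*} [Fintype Λ] [DecidableEq Λ]

/-- Labels of the computational basis: site `i` carries a qudit of dimension `q i`. -/
abbrev Config (q : Λ → ℕ) : Type _ := ∀ i, Fin (q i)

/-- Operators on the many-body Hilbert space, as matrices in the computational basis. The norm
is the operator norm. -/
abbrev Op (q : Λ → ℕ) : Type _ := Matrix (Config q) (Config q) ℂ

/-- `O` is the tensor product of an operator `M` on the qudits in `S` and the identity on the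
other qudits. -/
def SupportedOn {q : Λ → ℕ} (S : Finset Λ) (O : Op q) : Prop :=
  ∃ M : Matrix (∀ i : S, Fin (q i)) (∀ i : S, Fin (q i)) ℂ, ∀ x y : Config q,
    O x y = if ∀ i, i ∉ S → x i = y i then M (fun i => x i) (fun i => y i) else 0

end Operators

/-! ### Commuting projector Hamiltonians and syndromes -/

/-- The data of a commuting projector Hamiltonian `∑ f, coeff f • (1 - proj f)`. Several factors
`f : ι` may share a support. -/
structure CommutingProjectors {Λ : Type*} [Fintype Λ] [DecidableEq Λ]
    (G : SimpleGraph Λ) (q : Λ → ℕ) (ι : Type*) where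
  supp : ι → Finset Λ
  coeff : ι → ℝ
  proj : ι → Op q
  supp_connected : ∀ f, ConnectedSet G (supp f)
  proj_supported : ∀ f, SupportedOn (supp f) (proj f)
  proj_hermitian : ∀ f, (proj f).IsHermitian
  proj_sq : ∀ f, proj f * proj f = proj f
  proj_comm : ∀ f g, proj f * proj g = proj g * proj f

namespace CommutingProjectors

variable {Λ : Type*} [Fintype Λ] [DecidableEq Λ] {G : SimpleGraph Λ} {q : Λ → ℕ}
  {ι : Type*} [Fintype ι] [DecidableEq ι]

/-- The Hamiltonian. -/
def hamiltonian (C : CommutingProjectors G q ι) : Op q :=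
  ∑ f, (C.coeff f : ℂ) • (1 - C.proj f)

/-- The local ground state projector: the product of all projectors of factors inside `F`. -/
def localProj (C : CommutingProjectors G q ι) (F : Finset Λ) : Op q :=
  (Finset.univ.filter fun f => C.supp f ⊆ F).noncommProd C.proj
    fun f _ g _ _ => C.proj_comm f g

/-- Some state satisfies all local terms simultaneously. -/
def FrustrationFree (C : CommutingProjectors G q ι) : Prop :=
  C.localProj Finset.univ ≠ 0

/-- A normalized state satisfying all local terms. -/
def IsGroundState (C : CommutingProjectors G q ι) (ψ : Config q → ℂ) : Prop :=
  star ψ ⬝ᵥ ψ = 1 ∧ (C.localProj Finset.univ).mulVec ψ = ψ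

/-- `O` anticommutes with the checks `2 P_f - 1` for `f ∈ s` and commutes with the others. -/
def HasSyndrome (C : CommutingProjectors G q ι) (s : Finset ι) (O : Op q) : Prop :=
  (∀ f, f ∈ s → O * (2 * C.proj f - 1) = -((2 * C.proj f - 1) * O)) ∧
    ∀ f, f ∉ s → O * (2 * C.proj f - 1) = (2 * C.proj f - 1) * O

/-- `ψ` is an `R'`-locally nondegenerate ground state: an operator on a connected set `S` of at
most `cd * R' ^ d` sites, whose syndrome `s` consists of factors inside `S`, acts on `ψ` like an
operator on `F ⊆ S`, as soon as all factors in `s` meet `F` and every connected component of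
`S \ F` is adjacent to the complement of `S`. -/
def LocallyNondegenerate (C : CommutingProjectors G q ι) (d : ℕ) (cd R' : ℝ)
    (ψ : Config q → ℂ) : Prop :=
  ∀ (S F : Finset Λ) (s : Finset ι) (O : Op q),
    ConnectedSet G S → (S.card : ℝ) ≤ cd * R' ^ d →
    SupportedOn S O → C.HasSyndrome s O → (∀ f ∈ s, C.supp f ⊆ S) →
    F ⊆ S → (∀ f ∈ s, (C.supp f ∩ F).Nonempty) →
    (∀ X : (G.induce ((S \ F : Finset Λ) : Set Λ)).ConnectedComponent,
      ∃ i ∈ X.supp, ∃ j, j ∉ S ∧ G.Adj i.1 j) →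
    ∃ O' : Op q, SupportedOn F O' ∧ C.HasSyndrome s O' ∧ ‖O'‖ ≤ ‖O‖ ∧
      O.mulVec ψ = O'.mulVec ψ

/-! ### Local decompositions by support and syndrome -/

/-- A family `T S s` of local terms: `T S s` is supported in the connected set `S`, has syndrome
`s`, and `s` contains only factors inside `S` (so that `T S s` is strongly supported in `S`). -/
def IsLocalDecomposition (C : CommutingProjectors G q ι)
    (T : Finset Λ → Finset ι → Op q) : Prop :=
  ∀ S s, SupportedOn S (T S s) ∧ C.HasSyndrome s (T S s) ∧
    (T S s ≠ 0 → ConnectedSet G S ∧ ∀ f ∈ s, C.supp f ⊆ S)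

/-- All terms are supported on sets of diameter at most `ℓ`. -/
def FiniteRange (G : SimpleGraph Λ) (ℓ : ℕ) (T : Finset Λ → Finset ι → Op q) : Prop :=
  ∀ S s, T S s ≠ 0 → diam G S ≤ ℓ

/-- Every local term commutes with the local ground state projector of its support. -/
def LocallyBlockDiagonal (C : CommutingProjectors G q ι)
    (T : Finset Λ → Finset ι → Op q) : Prop :=
  ∀ S s, T S s * C.localProj S = C.localProj S * T S s

end CommutingProjectors

section Decompositions

variable {Λ : Type*} [Fintype Λ] [DecidableEq Λ] {q : Λ → ℕ} {ι : Type*} [Fintype ι]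

/-- The operator with local terms `T S s`. -/
def total (T : Finset Λ → Finset ι → Op q) : Op q := ∑ S, ∑ s, T S s

/-- The volume-local norm `max_i ∑_{S ∋ i, s} exp (K |S|) ‖T S s‖`. -/
def localNorm (K : ℝ) (T : Finset Λ → Finset ι → Op q) : ℝ :=
  ⨆ i : Λ, ∑ S ∈ Finset.univ.filter (fun S : Finset Λ => i ∈ S), ∑ s : Finset ι,
    Real.exp (K * (S.card : ℝ)) * ‖T S s‖

end Decompositions

/-! ### Local diagonalizability -/

section Diagonalizability

variable {Λ : Type*} [Fintype Λ] [DecidableEq Λ] {G : SimpleGraph Λ} {q : Λ → ℕ}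
  {ι : Type*} [Fintype ι] [DecidableEq ι]

/-- `W t` is the time-ordered exponential of `∫₀ᵗ A`, for `t ∈ [0, 1]`. -/
def IsTimeOrderedExp (A W : ℝ → Op q) : Prop :=
  ContinuousOn W (Set.Icc 0 1) ∧
    ∀ t ∈ Set.Icc (0 : ℝ) 1, W t = 1 + ∫ r in (0 : ℝ)..t, A r * W r

/-- `(H₀, V, ψ)` is `(v, δ, a, K)`-locally-diagonalizable, in the volume-local norms of the
syndrome decompositions defined by `C`. -/
def LocallyDiagonalizable (C : CommutingProjectors G q ι) (H₀ V : Op q) (ψ : Config q → ℂ)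
    (v δ a K : ℝ) : Prop :=
  ∃ (A : ℝ → Finset Λ → Finset ι → Op q) (W : ℝ → Op q),
    (∀ S s, IntervalIntegrable (fun r => A r S s) MeasureTheory.volume 0 1) ∧
    (∀ r ∈ Set.Icc (0 : ℝ) 1, C.IsLocalDecomposition (A r) ∧
      (total (A r)).conjTranspose = -total (A r) ∧ localNorm K (A r) ≤ a) ∧
    IsTimeOrderedExp (fun r => total (A r)) W ∧
    ∃ (Hs Vs : Op q), Hs.IsHermitian ∧ Vs.IsHermitian ∧
      Hs + Vs = (W 1).conjTranspose * (H₀ + V) * W 1 ∧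
      (∃ E : ℝ, Hs.mulVec ψ = (E : ℂ) • ψ) ∧
      (∃ T, C.IsLocalDecomposition T ∧ total T = Hs + Vs - H₀ ∧ localNorm K T ≤ δ) ∧
      (∃ T, C.IsLocalDecomposition T ∧ total T = Vs ∧ localNorm 0 T ≤ v)

end Diagonalizability

/-- The order `⌊c min((Δ/ε) / ln² (Δ/ε), R ^ d)⌋` of the perturbative expansion. -/
def optimalOrder (c Δ ε R : ℝ) (d : ℕ) : ℕ :=
  ⌊c * min ((Δ / ε) / Real.log (Δ / ε) ^ 2) (R ^ d)⌋₊

end FalseVacuum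

end

/-!
The rotation is built in `k` steps by a convergent iteration on local decompositions. After `n`
steps the Hamiltonian has the form `H + D + T + V`, where `H` is the commuting Hamiltonian, `D` its
block-diagonal perturbation, the terms of `T` have `ψ` as an eigenvector unless they are supported
on a large set, and the remainder `V` has norm `ε / 4 ^ n` (`IsStage`). The next generator `A` is
chosen such that `[H, A]` moves `V` to such a `T` (`exists_generator_family`), and the new remainder
consists of commutators with `A` (`IsStage.step`).

Solving for the generator works term by term (`exists_generator`). Let `O` be a term of `V` with
syndrome `s ≠ ∅`, supported on `S`. By local nondegeneracy, `O` acts on `ψ` like an operator `O'` on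
any `F ⊆ S` that contains the factors in `s` and leaves no holes in `S`. With the local ground state
projector `P` of `F`, the generator is `a = -(O' P - P O'ᴴ) / E`, where `E ≥ Δ |s|` is the energy of
the excitations `s`. Then `[H, a] = -(O' P + P O'ᴴ)`, which cancels the action of `O` on `ψ`; both
operators are block off-diagonal, so that no constant is lost in their norms. If `s = ∅`, then `F`
may be taken empty, so `O ψ` is already a multiple of `ψ`.

The commutator `[D, a]` is not small by the size of `S`, which may be as large as `R ^ d`, but only
the sites of `F` matter. The isoperimetric inequality bounds the holes that have to be added to the
factors in `s`: their number of sites is at most of order `R |s|` as long as `|S|` is at most a small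
multiple of `R ^ d` (`exists_filling_card_le`). As `R = Δ / δ` for the norm `δ` of `D`, the norm
`δ |F| ‖O‖ / E` of `[D, a]` is a small multiple of `‖O‖`, without a loss in the exponent of the
volume-local norm (`normBound_bracket_finiteRange`). All other commutators are small with `ε / Δ`,
but lose a part of the exponent; as each of `k` steps may lose only a fraction `1 / k` of it, this
is where `k ≤ c Δ / ε` is needed (`normBound_adSeries`). Finally, the terms supported on large sets
are exponentially small in `R ^ d`, hence smaller than `2 ^ (-k)` (`NormBound.of_large`).
-/

noncomputable section

set_option linter.unusedSectionVars false

namespace FalseVacuum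

open Matrix Finset

/-! ### Supports of operators -/

section Support

variable {Λ : Type*} [Fintype Λ] [DecidableEq Λ] {q : Λ → ℕ}

/-- An operator is supported on `S` iff its matrix elements vanish between configurations that
differ off `S` and depend only on the restrictions to `S` otherwise. -/
theorem supportedOn_iff {S : Finset Λ} {O : Op q} :
    SupportedOn S O ↔ (∀ x y : Config q, (∃ i, i ∉ S ∧ x i ≠ y i) → O x y = 0) ∧
      ∀ x y x' y' : Config q, (∀ i, i ∉ S → x i = y i) → (∀ i, i ∉ S → x' i = y' i) →
        (∀ i ∈ S, x i = x' i) → (∀ i ∈ S, y i = y' i) → O x y = O x' y' := by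
  constructor
  · rintro ⟨M, hM⟩
    refine ⟨fun x y ⟨i, hi, hne⟩ => ?_, fun x y x' y' h h' hx hy => ?_⟩
    · rw [hM, if_neg]
      exact fun h => hne (h i hi)
    · rw [hM, hM, if_pos h, if_pos h']
      congr 1
      · funext i
        exact hx i i.2
      · funext i
        exact hy i i.2
  · rintro ⟨h0, h1⟩
    by_cases hne : Nonempty (Config q)
    · obtain ⟨z⟩ := hne
      let e : (∀ i : S, Fin (q i)) → Config q := fun u i => if h : i ∈ S then u ⟨i, h⟩ else z i
      have he : ∀ u i (h : i ∈ S), e u i = u ⟨i, h⟩ := fun u i h => by simp [e, h]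
      have he' : ∀ u i, i ∉ S → e u i = z i := fun u i h => by simp [e, h]
      refine ⟨fun u v => O (e u) (e v), fun x y => ?_⟩
      split_ifs with h
      · refine h1 _ _ _ _ h
          (fun i hi => (he' (fun i => x i) i hi).trans (he' (fun i => y i) i hi).symm)
          (fun i hi => (he (fun i => x i) i hi).symm) fun i hi => (he (fun i => y i) i hi).symm
      · push Not at h
        exact h0 x y h
    · exact ⟨0, fun x => (hne ⟨x⟩).elim⟩

theorem SupportedOn.mono {S T : Finset Λ} {O : Op q} (h : SupportedOn S O) (hST : S ⊆ T) :
    SupportedOn T O := by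
  rw [supportedOn_iff] at h ⊢
  obtain ⟨h0, h1⟩ := h
  refine ⟨fun x y ⟨i, hi, hne⟩ => h0 x y ⟨i, fun hS => hi (hST hS), hne⟩,
    fun x y x' y' hxy hxy' hx hy => ?_⟩
  by_cases hc : ∃ i, i ∉ S ∧ x i ≠ y i
  · rw [h0 x y hc, h0 x' y']
    obtain ⟨i, hi, hne⟩ := hc
    have hiT : i ∈ T := by
      by_contra hiT
      exact hne (hxy i hiT)
    exact ⟨i, hi, by rwa [← hx i hiT, ← hy i hiT]⟩
  · push Not at hc
    refine h1 _ _ _ _ hc (fun i hi => ?_) (fun i hi => hx i (hST hi)) fun i hi => hy i (hST hi)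
    by_cases hiT : i ∈ T
    · rw [← hx i hiT, ← hy i hiT, hc i hi]
    · exact hxy' i hiT

theorem SupportedOn.zero (S : Finset Λ) : SupportedOn S (0 : Op q) :=
  ⟨0, fun x y => by simp⟩

theorem SupportedOn.add {S : Finset Λ} {A B : Op q} (hA : SupportedOn S A)
    (hB : SupportedOn S B) : SupportedOn S (A + B) := by
  obtain ⟨M, hM⟩ := hA
  obtain ⟨N, hN⟩ := hB
  refine ⟨M + N, fun x y => ?_⟩
  rw [Matrix.add_apply, hM, hN]
  split_ifs <;> simp

theorem SupportedOn.smul {S : Finset Λ} {A : Op q} (hA : SupportedOn S A) (c : ℂ) :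
    SupportedOn S (c • A) := by
  obtain ⟨M, hM⟩ := hA
  refine ⟨c • M, fun x y => ?_⟩
  rw [Matrix.smul_apply, hM]
  split_ifs <;> simp

theorem SupportedOn.neg {S : Finset Λ} {A : Op q} (hA : SupportedOn S A) :
    SupportedOn S (-A) := by
  simpa using hA.smul (-1)

theorem SupportedOn.sub {S : Finset Λ} {A B : Op q} (hA : SupportedOn S A)
    (hB : SupportedOn S B) : SupportedOn S (A - B) := by
  rw [sub_eq_add_neg]
  exact hA.add hB.neg

theorem SupportedOn.one (S : Finset Λ) : SupportedOn S (1 : Op q) := by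
  rw [supportedOn_iff]
  refine ⟨fun x y ⟨i, _, hne⟩ => Matrix.one_apply_ne fun h => hne (congrFun h i),
    fun x y x' y' hxy hxy' hx hy => ?_⟩
  rw [Matrix.one_apply, Matrix.one_apply]
  congr 1
  refine propext ⟨fun h => funext fun i => ?_, fun h => funext fun i => ?_⟩
  · by_cases hi : i ∈ S
    · rw [← hx i hi, ← hy i hi, h]
    · exact hxy' i hi
  · by_cases hi : i ∈ S
    · rw [hx i hi, hy i hi, h]
    · exact hxy i hi

theorem SupportedOn.conjTranspose {S : Finset Λ} {A : Op q} (hA : SupportedOn S A) :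
    SupportedOn S Aᴴ := by
  obtain ⟨M, hM⟩ := hA
  refine ⟨Mᴴ, fun x y => ?_⟩
  rw [Matrix.conjTranspose_apply, hM]
  by_cases h : ∀ i, i ∉ S → x i = y i
  · rw [if_pos h, if_pos fun i hi => (h i hi).symm, Matrix.conjTranspose_apply]
  · rw [if_neg h, if_neg fun h' => h fun i hi => (h' i hi).symm, star_zero]

theorem SupportedOn.mul {S : Finset Λ} {A B : Op q} (hA : SupportedOn S A)
    (hB : SupportedOn S B) : SupportedOn S (A * B) := by
  rw [supportedOn_iff] at hA hB ⊢
  obtain ⟨hA0, hA1⟩ := hA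
  obtain ⟨hB0, hB1⟩ := hB
  refine ⟨fun x y ⟨i, hi, hne⟩ => ?_, fun x y x' y' hxy hxy' hx hy => ?_⟩
  · rw [Matrix.mul_apply]
    refine Finset.sum_eq_zero fun z _ => ?_
    by_cases hz : x i = z i
    · rw [hB0 z y ⟨i, hi, hz ▸ hne⟩, mul_zero]
    · rw [hA0 x z ⟨i, hi, hz⟩, zero_mul]
  · -- Off `S`, the permutation `σ` exchanges the values of `x` and `x'`; it carries the
    -- intermediate configurations of one product to those of the other.
    let σ : Config q ≃ Config q := Equiv.piCongrRight fun i =>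
      if i ∈ S then Equiv.refl _ else Equiv.swap (x i) (x' i)
    have hσ : ∀ z i, i ∈ S → σ z i = z i := fun z i hi => by simp [σ, hi]
    have hσ' : ∀ z i, i ∉ S → σ z i = Equiv.swap (x i) (x' i) (z i) := fun z i hi => by
      simp [σ, hi]
    have key : ∀ z i, i ∉ S → (x i = z i ↔ x' i = σ z i) := fun z i hi => by
      rw [hσ' z i hi, eq_comm, ← (Equiv.swap (x i) (x' i)).injective.eq_iff, Equiv.swap_apply_left,
        eq_comm]
    rw [Matrix.mul_apply, Matrix.mul_apply, ← Equiv.sum_comp σ (fun z => A x' z * B z y')]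
    refine Finset.sum_congr rfl fun z _ => ?_
    by_cases hz : ∀ i, i ∉ S → x i = z i
    · have hz' : ∀ i, i ∉ S → x' i = σ z i := fun i hi => (key z i hi).1 (hz i hi)
      rw [hA1 x z x' (σ z) hz hz' hx fun i hi => (hσ z i hi).symm,
        hB1 z y (σ z) y' (fun i hi => (hz i hi).symm.trans (hxy i hi))
          (fun i hi => (hz' i hi).symm.trans (hxy' i hi)) (fun i hi => (hσ z i hi).symm) hy]
    · push Not at hz
      obtain ⟨i, hi, hne⟩ := hz
      rw [hA0 x z ⟨i, hi, hne⟩, hA0 x' (σ z) ⟨i, hi, fun h => hne ((key z i hi).2 h)⟩, zero_mul,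
        zero_mul]

/-- Matrix elements of a product of operators with disjoint supports. -/
theorem SupportedOn.mul_apply_of_disjoint {S T : Finset Λ} {A B : Op q} (hA : SupportedOn S A)
    (hB : SupportedOn T B) (hST : Disjoint S T) (x y z : Config q)
    (hzS : ∀ i ∈ S, z i = y i) (hzS' : ∀ i, i ∉ S → z i = x i) :
    (A * B) x y = A x z * B z y := by
  rw [supportedOn_iff] at hA hB
  rw [Matrix.mul_apply]
  refine Finset.sum_eq_single z (fun w _ hw => ?_) (by simp)
  obtain ⟨i, hi⟩ := Function.ne_iff.1 hw
  by_cases hiS : i ∈ S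
  · rw [hB.1 w y ⟨i, Finset.disjoint_left.1 hST hiS, by rwa [← hzS i hiS]⟩, mul_zero]
  · rw [hA.1 x w ⟨i, hiS, by rw [← hzS' i hiS]; exact hi.symm⟩, zero_mul]

theorem SupportedOn.commute {S T : Finset Λ} {A B : Op q} (hA : SupportedOn S A)
    (hB : SupportedOn T B) (hST : Disjoint S T) : A * B = B * A := by
  ext x y
  let z : Config q := fun i => if i ∈ S then y i else x i
  let w : Config q := fun i => if i ∈ T then y i else x i
  rw [hA.mul_apply_of_disjoint hB hST x y z (fun i hi => by simp [z, hi])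
      (fun i hi => by simp [z, hi]),
    hB.mul_apply_of_disjoint hA hST.symm x y w (fun i hi => by simp [w, hi])
      (fun i hi => by simp [w, hi])]
  rw [supportedOn_iff] at hA hB
  by_cases h : ∀ i, i ∉ S → i ∉ T → x i = y i
  · have h1 : A x z = A w y := by
      refine hA.2 _ _ _ _ (fun i hi => by simp [z, hi]) (fun i hi => ?_) (fun i hi => ?_)
        fun i hi => by simp [z, hi]
      · by_cases hiT : i ∈ T
        · simp [w, hiT]
        · simp [w, hiT, h i hi hiT]
      · simp [w, Finset.disjoint_left.1 hST hi]
    have h2 : B x w = B z y := by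
      refine hB.2 _ _ _ _ (fun i hi => by simp [w, hi]) (fun i hi => ?_) (fun i hi => ?_)
        fun i hi => by simp [w, hi]
      · by_cases hiS : i ∈ S
        · simp [z, hiS]
        · simp [z, hiS, h i hiS hi]
      · simp [z, Finset.disjoint_right.1 hST hi]
    rw [h1, h2, mul_comm]
  · push Not at h
    obtain ⟨i, hiS, hiT, hne⟩ := h
    rw [hB.1 z y ⟨i, hiT, by simpa [z, hiS] using hne⟩,
      hA.1 w y ⟨i, hiS, by simpa [w, hiT] using hne⟩, mul_zero, mul_zero]

theorem SupportedOn.eq_smul_one {A : Op q} (hA : SupportedOn ∅ A) : ∃ c : ℂ, A = c • 1 := by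
  obtain ⟨M, hM⟩ := hA
  refine ⟨M (fun i => absurd i.2 (Finset.notMem_empty _))
    (fun i => absurd i.2 (Finset.notMem_empty _)), ?_⟩
  ext x y
  rw [hM, Matrix.smul_apply, Matrix.one_apply]
  by_cases h : x = y
  · subst h
    simp only [implies_true, if_true, smul_eq_mul, mul_one]
    congr 1 <;> exact Subsingleton.elim _ _
  · rw [if_neg, if_neg h, smul_zero]
    exact fun h' => h (funext fun i => h' i (Finset.notMem_empty i))

end Support

/-! ### Syndromes and local projectors -/

namespace CommutingProjectors

variable {Λ : Type*} [Fintype Λ] [DecidableEq Λ] {G : SimpleGraph Λ} {q : Λ → ℕ}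
  {ι : Type*} {C : CommutingProjectors G q ι}

/-- A syndrome in terms of the projectors: an operator exchanges the two values of the checks in
the syndrome and preserves the others. -/
theorem hasSyndrome_iff {s : Finset ι} {O : Op q} :
    C.HasSyndrome s O ↔ (∀ f ∈ s, C.proj f * O = O - O * C.proj f) ∧
      ∀ f, f ∉ s → C.proj f * O = O * C.proj f := by
  have two : (2 : Op q) = (2 : ℂ) • 1 := by
    rw [← one_add_one_eq_two, ← one_add_one_eq_two, add_smul, one_smul]
  have e1 : ∀ f, O * (2 * C.proj f - 1) = (2 : ℂ) • (O * C.proj f) - O := fun f => by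
    rw [two, smul_mul_assoc, one_mul, mul_sub, mul_smul_comm, mul_one]
  have e2 : ∀ f, (2 * C.proj f - 1) * O = (2 : ℂ) • (C.proj f * O) - O := fun f => by
    rw [two, smul_mul_assoc, one_mul, sub_mul, smul_mul_assoc, one_mul]
  have h2 : (2 : ℂ) ≠ 0 := two_ne_zero
  unfold HasSyndrome
  simp only [e1, e2]
  refine and_congr (forall_congr' fun f => imp_congr_right fun _ => ?_)
    (forall_congr' fun f => imp_congr_right fun _ => ?_)
  · rw [← (smul_right_injective (Op q) h2).eq_iff (a := C.proj f * O)]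
    simp only [smul_sub]
    have : (2 : ℂ) • O = O + O := two_smul ℂ O
    rw [this]
    constructor <;> intro h
    · rw [← sub_eq_zero] at h ⊢
      rw [← h]; abel
    · rw [h]; abel
  · rw [sub_left_inj, (smul_right_injective (Op q) h2).eq_iff, eq_comm]

theorem HasSyndrome.zero (s : Finset ι) : C.HasSyndrome s 0 := by
  simp [hasSyndrome_iff]

theorem HasSyndrome.add {s : Finset ι} {A B : Op q} (hA : C.HasSyndrome s A)
    (hB : C.HasSyndrome s B) : C.HasSyndrome s (A + B) := by
  rw [hasSyndrome_iff] at *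
  refine ⟨fun f hf => ?_, fun f hf => ?_⟩
  · rw [mul_add, add_mul, hA.1 f hf, hB.1 f hf]; abel
  · rw [mul_add, add_mul, hA.2 f hf, hB.2 f hf]

theorem HasSyndrome.smul {s : Finset ι} {A : Op q} (hA : C.HasSyndrome s A) (c : ℂ) :
    C.HasSyndrome s (c • A) := by
  rw [hasSyndrome_iff] at *
  refine ⟨fun f hf => ?_, fun f hf => ?_⟩
  · rw [mul_smul_comm, smul_mul_assoc, hA.1 f hf, smul_sub]
  · rw [mul_smul_comm, smul_mul_assoc, hA.2 f hf]

theorem HasSyndrome.neg {s : Finset ι} {A : Op q} (hA : C.HasSyndrome s A) :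
    C.HasSyndrome s (-A) := by
  simpa using hA.smul (-1)

theorem HasSyndrome.sub {s : Finset ι} {A B : Op q} (hA : C.HasSyndrome s A)
    (hB : C.HasSyndrome s B) : C.HasSyndrome s (A - B) := by
  rw [sub_eq_add_neg]
  exact hA.add hB.neg

theorem HasSyndrome.conjTranspose {s : Finset ι} {A : Op q} (hA : C.HasSyndrome s A) :
    C.HasSyndrome s Aᴴ := by
  rw [hasSyndrome_iff] at *
  refine ⟨fun f hf => ?_, fun f hf => ?_⟩
  · have h := congrArg Matrix.conjTranspose (hA.1 f hf)
    rw [Matrix.conjTranspose_mul, Matrix.conjTranspose_sub, Matrix.conjTranspose_mul,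
      (C.proj_hermitian f).eq] at h
    rw [h]; abel
  · have h := congrArg Matrix.conjTranspose (hA.2 f hf)
    rw [Matrix.conjTranspose_mul, Matrix.conjTranspose_mul, (C.proj_hermitian f).eq] at h
    exact h.symm

theorem HasSyndrome.mul [DecidableEq ι] {s t : Finset ι} {A B : Op q} (hA : C.HasSyndrome s A)
    (hB : C.HasSyndrome t B) : C.HasSyndrome (symmDiff s t) (A * B) := by
  rw [hasSyndrome_iff] at *
  refine ⟨fun f hf => ?_, fun f hf => ?_⟩
  · rcases Finset.mem_symmDiff.1 hf with ⟨h1, h2⟩ | ⟨h1, h2⟩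
    · rw [← mul_assoc, hA.1 f h1, sub_mul, mul_assoc, hB.2 f h2, mul_assoc]
    · rw [← mul_assoc, hA.2 f h2, mul_assoc, hB.1 f h1, mul_sub, mul_assoc]
  · by_cases h1 : f ∈ s
    · have h2 : f ∈ t := by
        by_contra h2
        exact hf (Finset.mem_symmDiff.2 (Or.inl ⟨h1, h2⟩))
      rw [← mul_assoc, hA.1 f h1, sub_mul, mul_assoc, hB.1 f h2, mul_sub, mul_assoc]; abel
    · have h2 : f ∉ t := fun h2 => hf (Finset.mem_symmDiff.2 (Or.inr ⟨h2, h1⟩))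
      rw [← mul_assoc, hA.2 f h1, mul_assoc, hB.2 f h2, mul_assoc]

variable [Fintype ι] [DecidableEq ι]

theorem localProj_induction (F : Finset Λ) (p : Op q → Prop) (hmul : ∀ a b, p a → p b → p (a * b))
    (hone : p 1) (h : ∀ f, C.supp f ⊆ F → p (C.proj f)) : p (C.localProj F) :=
  Finset.noncommProd_induction _ _ _ p hmul hone fun f hf => h f (Finset.mem_filter.1 hf).2

theorem localProj_supported (F : Finset Λ) : SupportedOn F (C.localProj F) :=
  localProj_induction F _ (fun _ _ => SupportedOn.mul) (SupportedOn.one F)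
    fun f hf => (C.proj_supported f).mono hf

theorem commute_localProj {F : Finset Λ} {A : Op q}
    (h : ∀ f, C.supp f ⊆ F → A * C.proj f = C.proj f * A) :
    A * C.localProj F = C.localProj F * A :=
  localProj_induction (C := C) F (fun P => A * P = P * A)
    (fun a b ha hb => by rw [← mul_assoc, ha, mul_assoc, hb, mul_assoc]) (by simp) h

theorem localProj_mul_proj (F : Finset Λ) (f : ι) (hf : C.supp f ⊆ F) :
    C.localProj F * C.proj f = C.localProj F := by
  have hmem : f ∈ Finset.univ.filter fun f => C.supp f ⊆ F := by simpa using hf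
  have h := Finset.noncommProd_erase_mul _ hmem C.proj fun f _ g _ _ => C.proj_comm f g
  change _ = C.localProj F at h
  rw [← h, mul_assoc, C.proj_sq]

theorem proj_mul_localProj (F : Finset Λ) (f : ι) (hf : C.supp f ⊆ F) :
    C.proj f * C.localProj F = C.localProj F := by
  rw [commute_localProj fun g _ => C.proj_comm f g, localProj_mul_proj F f hf]

theorem localProj_mul_self (F : Finset Λ) : C.localProj F * C.localProj F = C.localProj F :=
  localProj_induction (C := C) F (fun P => C.localProj F * P = C.localProj F)
    (fun a b ha hb => by rw [← mul_assoc, ha, hb]) (by simp) fun f hf => localProj_mul_proj F f hf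

theorem localProj_hermitian (F : Finset Λ) : (C.localProj F).IsHermitian := by
  have key : (∀ g, C.localProj F * C.proj g = C.proj g * C.localProj F) ∧
      (C.localProj F)ᴴ * C.localProj F = C.localProj F := by
    refine ⟨fun g => (commute_localProj fun f _ => C.proj_comm g f).symm, ?_⟩
    refine localProj_induction (C := C) F (fun P => Pᴴ * C.localProj F = C.localProj F)
      (fun a b ha hb => by rw [Matrix.conjTranspose_mul, mul_assoc, ha, hb]) (by simp)
      fun f hf => by rw [(C.proj_hermitian f).eq, proj_mul_localProj F f hf]
  have h := congrArg Matrix.conjTranspose key.2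
  rw [Matrix.conjTranspose_mul, Matrix.conjTranspose_conjTranspose, key.2] at h
  exact h.symm

theorem localProj_hasSyndrome (F : Finset Λ) : C.HasSyndrome ∅ (C.localProj F) := by
  rw [hasSyndrome_iff]
  exact ⟨by simp, fun f _ => commute_localProj fun g _ => C.proj_comm f g⟩

/-- An operator with nontrivial syndrome inside `F` maps the local ground states of `F` to
excited states. -/
theorem localProj_mul_mul_localProj {s : Finset ι} {A : Op q} (hA : C.HasSyndrome s A)
    (F : Finset Λ) (f : ι) (hfs : f ∈ s) (hf : C.supp f ⊆ F) :
    C.localProj F * A * C.localProj F = 0 := by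
  rw [hasSyndrome_iff] at hA
  have h : C.localProj F * (C.proj f * A) * C.localProj F = 0 := by
    rw [hA.1 f hfs, mul_assoc, sub_mul, mul_assoc A, proj_mul_localProj F f hf, sub_self, mul_zero]
  rwa [← mul_assoc, localProj_mul_proj F f hf] at h

theorem proj_mulVec {ψ : Config q → ℂ} (hψ : C.IsGroundState ψ) (f : ι) :
    (C.proj f).mulVec ψ = ψ := by
  have h := hψ.2
  conv_lhs => rw [← h]
  rw [Matrix.mulVec_mulVec, proj_mul_localProj _ f (Finset.subset_univ _), h]

theorem localProj_mulVec {ψ : Config q → ℂ} (hψ : C.IsGroundState ψ) (F : Finset Λ) :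
    (C.localProj F).mulVec ψ = ψ :=
  localProj_induction (C := C) F (fun P => P.mulVec ψ = ψ)
    (fun a b ha hb => by rw [← Matrix.mulVec_mulVec, hb, ha]) (by simp)
    fun f _ => proj_mulVec hψ f

theorem localProj_mulVec_eq_zero {s : Finset ι} {A : Op q} (hA : C.HasSyndrome s A)
    {ψ : Config q → ℂ} (hψ : C.IsGroundState ψ)
    (F : Finset Λ) (f : ι) (hfs : f ∈ s) (hf : C.supp f ⊆ F) :
    (C.localProj F * A).mulVec ψ = 0 := by
  conv_lhs => rw [← localProj_mulVec hψ F]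
  rw [Matrix.mulVec_mulVec, localProj_mul_mul_localProj hA F f hfs hf, Matrix.zero_mulVec]

theorem hamiltonian_mulVec {ψ : Config q → ℂ} (hψ : C.IsGroundState ψ) :
    C.hamiltonian.mulVec ψ = 0 := by
  unfold hamiltonian
  rw [Matrix.sum_mulVec]
  refine Finset.sum_eq_zero fun f _ => ?_
  rw [Matrix.smul_mulVec, Matrix.sub_mulVec, Matrix.one_mulVec, proj_mulVec hψ, sub_self,
    smul_zero]

theorem hamiltonian_isHermitian : C.hamiltonian.IsHermitian := by
  unfold hamiltonian Matrix.IsHermitian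
  rw [Matrix.conjTranspose_sum]
  refine Finset.sum_congr rfl fun f _ => ?_
  rw [Matrix.conjTranspose_smul, Matrix.conjTranspose_sub, (C.proj_hermitian f).eq,
    Matrix.conjTranspose_one]
  simp

/-- Creating the excitations `s` on top of local ground states of a region containing them costs
the energy `∑ f ∈ s, coeff f`. -/
theorem hamiltonian_commutator {s : Finset ι} {A : Op q} (hA : C.HasSyndrome s A)
    (F : Finset Λ) (hF : ∀ f ∈ s, C.supp f ⊆ F) :
    C.hamiltonian * (A * C.localProj F) - A * C.localProj F * C.hamiltonian =
      ((∑ f ∈ s, C.coeff f : ℝ) : ℂ) • (A * C.localProj F) := by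
  rw [hasSyndrome_iff] at hA
  have hterm : ∀ f, (1 - C.proj f) * (A * C.localProj F) - A * C.localProj F * (1 - C.proj f) =
      if f ∈ s then A * C.localProj F else 0 := by
    intro f
    split_ifs with hf
    · have h1 : C.proj f * (A * C.localProj F) = 0 := by
        rw [← mul_assoc, hA.1 f hf, sub_mul, mul_assoc, proj_mul_localProj F f (hF f hf), sub_self]
      have h2 : A * C.localProj F * C.proj f = A * C.localProj F := by
        rw [mul_assoc, localProj_mul_proj F f (hF f hf)]
      rw [sub_mul, mul_sub, h1, h2]; simp
    · have h1 : C.proj f * (A * C.localProj F) = A * C.localProj F * C.proj f := by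
        rw [← mul_assoc, hA.2 f hf, mul_assoc, mul_assoc,
          commute_localProj fun g _ => C.proj_comm f g]
      rw [sub_mul, mul_sub, h1]; simp
  unfold hamiltonian
  rw [Finset.sum_mul, Finset.mul_sum, ← Finset.sum_sub_distrib]
  simp_rw [smul_mul_assoc, mul_smul_comm, ← smul_sub, hterm, smul_ite, smul_zero]
  rw [Finset.sum_ite_mem, Finset.univ_inter, ← Finset.sum_smul, Complex.ofReal_sum]

end CommutingProjectors

/-! ### Norms of block off-diagonal operators -/

section Norms

theorem norm_mul_proj_add_le {E : Type*} [NormedAddCommGroup E] [InnerProductSpace ℂ E]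
    [CompleteSpace E] {P X : E →L[ℂ] E} (hP : star P = P) (hPP : P * P = P) (hX : P * X * P = 0)
    (c : ℂ) (hc : ‖c‖ = 1) : ‖X * P + c • (P * star X)‖ ≤ ‖X‖ := by
  have hsym : ∀ v w, inner ℂ (P v) w = inner ℂ v (P w) := fun v w => by
    conv_lhs => rw [← hP]
    rw [ContinuousLinearMap.star_eq_adjoint, ContinuousLinearMap.adjoint_inner_left]
  have hX' : P * star X * P = 0 := by
    have := congrArg star hX
    rwa [star_mul, star_mul, hP, star_zero, ← mul_assoc] at this
  have hpyth : ∀ v w : E, inner ℂ v w = (0 : ℂ) → ‖v + w‖ ^ 2 = ‖v‖ ^ 2 + ‖w‖ ^ 2 := fun v w h => by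
    rw [sq, sq, sq, norm_add_sq_eq_norm_sq_add_norm_sq_of_inner_eq_zero v w h]
  have hPle : ∀ v, ‖P v‖ ^ 2 ≤ ‖v‖ ^ 2 := fun v => by
    have h := hpyth (P v) (v - P v) (by
      rw [hsym, map_sub, ← mul_apply_eq_comp, hPP, sub_self, inner_zero_right])
    rw [add_sub_cancel] at h
    nlinarith [sq_nonneg ‖v - P v‖]
  refine ContinuousLinearMap.opNorm_le_bound _ (norm_nonneg _) fun v => ?_
  have h0 : ∀ v, P (X (P v)) = 0 := fun v => congrArg (fun T : E →L[ℂ] E => T v) hX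
  have h0' : P (star X (P v)) = 0 := congrArg (fun T : E →L[ℂ] E => T v) hX'
  have h1 := hpyth (X (P v)) (c • P (star X v)) (by
    rw [inner_smul_right, ← hsym, h0, inner_zero_left, mul_zero])
  have h2 := hpyth (P v) (v - P v) (by
    rw [hsym, map_sub, ← mul_apply_eq_comp, hPP, sub_self, inner_zero_right])
  rw [add_sub_cancel] at h2
  have h3 : ‖c • P (star X v)‖ ^ 2 ≤ ‖X‖ ^ 2 * ‖v - P v‖ ^ 2 := by
    have : P (star X v) = P (star X (v - P v)) := by rw [map_sub, map_sub, h0', sub_zero]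
    rw [norm_smul, hc, one_mul, this]
    refine (hPle _).trans ?_
    rw [← mul_pow]
    refine pow_le_pow_left₀ (norm_nonneg _) ?_ 2
    rw [← norm_star X]
    exact ContinuousLinearMap.le_opNorm _ _
  have h4 : ‖X (P v)‖ ^ 2 ≤ ‖X‖ ^ 2 * ‖P v‖ ^ 2 := by
    rw [← mul_pow]
    exact pow_le_pow_left₀ (norm_nonneg _) (ContinuousLinearMap.le_opNorm _ _) 2
  have h5 : ‖X (P v) + c • P (star X v)‖ ^ 2 ≤ (‖X‖ * ‖v‖) ^ 2 := by
    rw [h1, mul_pow, h2]; linarith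
  exact (le_abs_self _).trans (abs_le_of_sq_le_sq h5 (by positivity))

/-- If `P X P = 0` for a projector `P`, then `X P` and `P Xᴴ` have orthogonal ranges and orthogonal
supports, so that a combination of them has at most the norm of `X`. -/
theorem norm_mul_proj_add_le_matrix {n : Type*} [Fintype n] [DecidableEq n] {P X : Matrix n n ℂ}
    (hP : P.IsHermitian) (hPP : P * P = P) (hX : P * X * P = 0) (c : ℂ) (hc : ‖c‖ = 1) :
    ‖X * P + c • (P * Xᴴ)‖ ≤ ‖X‖ := by
  let φ := Matrix.toEuclideanCLM (𝕜 := ℂ) (n := n)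
  have h : ‖φ X * φ P + c • (φ P * star (φ X))‖ ≤ ‖φ X‖ := by
    refine norm_mul_proj_add_le ?_ ?_ ?_ c hc
    · rw [← map_star, Matrix.star_eq_conjTranspose, hP.eq]
    · rw [← map_mul, hPP]
    · rw [← map_mul, ← map_mul, hX, map_zero]
  rw [← map_star, ← map_mul, ← map_mul, ← map_smul, ← map_add] at h
  exact h

end Norms

/-! ### Local decompositions -/

section Decomposition

variable {Λ : Type*} [Fintype Λ] [DecidableEq Λ] {G : SimpleGraph Λ} {q : Λ → ℕ}
  {ι : Type*} [Fintype ι] [DecidableEq ι] {C : CommutingProjectors G q ι}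

/-- The operators that may occur as the term with support `S` and syndrome `s` of a local
decomposition. -/
def termSpace (C : CommutingProjectors G q ι) (S : Finset Λ) (s : Finset ι) :
    Submodule ℂ (Op q) where
  carrier := {O | SupportedOn S O ∧ C.HasSyndrome s O ∧
    (O ≠ 0 → ConnectedSet G S ∧ ∀ f ∈ s, C.supp f ⊆ S)}
  zero_mem' := ⟨SupportedOn.zero S, CommutingProjectors.HasSyndrome.zero s, fun h => (h rfl).elim⟩
  add_mem' := by
    rintro A B ⟨hA, hA', hA''⟩ ⟨hB, hB', hB''⟩
    refine ⟨hA.add hB, hA'.add hB', fun h => ?_⟩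
    by_cases h0 : A = 0
    · exact hB'' fun h1 => h (by rw [h0, h1, add_zero])
    · exact hA'' h0
  smul_mem' := by
    rintro c A ⟨hA, hA', hA''⟩
    exact ⟨hA.smul c, hA'.smul c, fun h => hA'' fun h0 => h (by rw [h0, smul_zero])⟩

theorem isLocalDecomposition_iff {T : Finset Λ → Finset ι → Op q} :
    C.IsLocalDecomposition T ↔ ∀ S s, T S s ∈ termSpace C S s := Iff.rfl

theorem conjTranspose_mem_termSpace {S : Finset Λ} {s : Finset ι} {A : Op q}
    (hA : A ∈ termSpace C S s) : Aᴴ ∈ termSpace C S s :=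
  ⟨hA.1.conjTranspose, hA.2.1.conjTranspose, fun h => hA.2.2 fun h0 => h (by simp [h0])⟩

/-- The sum over all terms of the weights of those whose support contains `i`. -/
def siteSum (w : Finset Λ × Finset ι → ℝ) (i : Λ) : ℝ :=
  ∑ p, if i ∈ p.1 then w p else 0

theorem siteSum_mono {w w' : Finset Λ × Finset ι → ℝ} (h : ∀ p, w p ≤ w' p) (i : Λ) :
    siteSum w i ≤ siteSum w' i :=
  Finset.sum_le_sum fun p _ => by split_ifs <;> simp [h]

theorem siteSum_add (w w' : Finset Λ × Finset ι → ℝ) (i : Λ) :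
    siteSum (fun p => w p + w' p) i = siteSum w i + siteSum w' i := by
  unfold siteSum
  rw [← Finset.sum_add_distrib]
  exact Finset.sum_congr rfl fun p _ => by split_ifs <;> simp

theorem siteSum_mul (c : ℝ) (w : Finset Λ × Finset ι → ℝ) (i : Λ) :
    siteSum (fun p => c * w p) i = c * siteSum w i := by
  unfold siteSum
  rw [Finset.mul_sum]
  exact Finset.sum_congr rfl fun p _ => by split_ifs <;> simp

theorem siteSum_nonneg {w : Finset Λ × Finset ι → ℝ} (h : ∀ p, 0 ≤ w p) (i : Λ) :
    0 ≤ siteSum w i :=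
  Finset.sum_nonneg fun p _ => by split_ifs <;> simp [h]

/-- The volume-local norm of the decomposition `T` is at most `c`. For a nonempty set of sites, this
is `localNorm K T ≤ c`. -/
def NormBound (K : ℝ) (T : Finset Λ → Finset ι → Op q) (c : ℝ) : Prop :=
  ∀ i, siteSum (fun p => Real.exp (K * (p.1.card : ℝ)) * ‖T p.1 p.2‖) i ≤ c

theorem siteSum_eq (w : Finset Λ → Finset ι → ℝ) (i : Λ) :
    ∑ S ∈ Finset.univ.filter (fun S : Finset Λ => i ∈ S), ∑ s : Finset ι, w S s =
      siteSum (fun p => w p.1 p.2) i := by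
  unfold siteSum
  rw [Fintype.sum_prod_type, Finset.sum_filter]
  refine Finset.sum_congr rfl fun S _ => ?_
  split_ifs <;> simp

theorem NormBound.localNorm_le [Nonempty Λ] {K c : ℝ} {T : Finset Λ → Finset ι → Op q}
    (h : NormBound K T c) : localNorm K T ≤ c :=
  ciSup_le fun i => (siteSum_eq _ i).trans_le (h i)

theorem normBound_of_localNorm_le {K c : ℝ} {T : Finset Λ → Finset ι → Op q}
    (h : localNorm K T ≤ c) : NormBound K T c := fun i =>
  (siteSum_eq (fun S s => Real.exp (K * (S.card : ℝ)) * ‖T S s‖) i).symm.trans_le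
    ((le_ciSup (f := fun i : Λ => ∑ S ∈ Finset.univ.filter (fun S : Finset Λ => i ∈ S),
      ∑ s : Finset ι, Real.exp (K * (S.card : ℝ)) * ‖T S s‖) (Set.finite_range _).bddAbove i).trans h)

variable {K K' b c : ℝ} {T T' : Finset Λ → Finset ι → Op q}

theorem NormBound.mono (h : NormBound K T c) (hK : K' ≤ K) (hc : c ≤ b) : NormBound K' T b :=
  fun i => (siteSum_mono (fun p => by gcongr) i).trans ((h i).trans hc)

theorem NormBound.of_norm_le (h : NormBound K T c) (hT : ∀ S s, ‖T' S s‖ ≤ ‖T S s‖) :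
    NormBound K T' c :=
  fun i => (siteSum_mono (fun p => by gcongr; exact hT _ _) i).trans (h i)

theorem NormBound.of_norm_le_mul (h : NormBound K T c) (hb : 0 ≤ b)
    (hT : ∀ S s, ‖T' S s‖ ≤ b * ‖T S s‖) : NormBound K T' (b * c) := fun i => by
  refine (siteSum_mono (w' := fun p => b * (Real.exp (K * (p.1.card : ℝ)) * ‖T p.1 p.2‖))
    (fun p => ?_) i).trans ?_
  · rw [mul_left_comm]
    gcongr
    exact hT _ _
  · rw [siteSum_mul]
    gcongr
    exact h i

theorem NormBound.add (h : NormBound K T b) (h' : NormBound K T' c) :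
    NormBound K (fun S s => T S s + T' S s) (b + c) := fun i => by
  refine (siteSum_mono (w' := fun p => Real.exp (K * (p.1.card : ℝ)) * ‖T p.1 p.2‖ +
    Real.exp (K * (p.1.card : ℝ)) * ‖T' p.1 p.2‖) (fun p => ?_) i).trans ?_
  · rw [← mul_add]
    gcongr
    exact norm_add_le _ _
  · rw [siteSum_add]
    exact add_le_add (h i) (h' i)

theorem NormBound.zero (K : ℝ) : NormBound K (0 : Finset Λ → Finset ι → Op q) 0 := fun i => by
  simp [siteSum]

theorem NormBound.nonneg [Nonempty Λ] (h : NormBound K T c) : 0 ≤ c :=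
  (siteSum_nonneg (fun p => by positivity) (Classical.arbitrary Λ)).trans (h _)

theorem NormBound.norm_le (h : NormBound K T c) (hK : 0 ≤ K) {S : Finset Λ} (hS : S.Nonempty)
    (s : Finset ι) : ‖T S s‖ ≤ c := by
  obtain ⟨i, hi⟩ := hS
  refine le_trans ?_ (h i)
  refine le_trans ?_ (Finset.single_le_sum (f := fun p : Finset Λ × Finset ι =>
    if i ∈ p.1 then Real.exp (K * (p.1.card : ℝ)) * ‖T p.1 p.2‖ else 0)
    (fun p _ => by positivity) (Finset.mem_univ (S, s)))
  simp only [hi, if_true]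
  exact le_mul_of_one_le_left (norm_nonneg _) (Real.one_le_exp (by positivity))

/-- Lowering the exponent of a volume-local norm pays for a factor of the volume. -/
theorem NormBound.siteSum_card_le (h : NormBound K T c) (hK : K' < K) (i : Λ) :
    siteSum (fun p => (p.1.card : ℝ) * (Real.exp (K' * (p.1.card : ℝ)) * ‖T p.1 p.2‖)) i ≤
      c / (K - K') := by
  have hpos : 0 < K - K' := sub_pos.2 hK
  rw [le_div_iff₀ hpos, mul_comm, ← siteSum_mul]
  refine (siteSum_mono (fun p => ?_) i).trans (h i)
  have h1 : (K - K') * (p.1.card : ℝ) ≤ Real.exp ((K - K') * (p.1.card : ℝ)) := by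
    linarith [Real.add_one_le_exp ((K - K') * (p.1.card : ℝ))]
  have h2 : Real.exp (K * (p.1.card : ℝ)) =
      Real.exp ((K - K') * (p.1.card : ℝ)) * Real.exp (K' * (p.1.card : ℝ)) := by
    rw [← Real.exp_add]; ring_nf
  rw [h2, ← mul_assoc, ← mul_assoc]
  gcongr

/-- Terms supported on large sets are small in a norm with a smaller exponent. -/
theorem NormBound.of_large (h : NormBound K T c) (hK : 0 ≤ K) (M : ℝ)
    (hT : ∀ S s, T' S s ≠ 0 → M ≤ (S.card : ℝ)) (hTT : ∀ S s, ‖T' S s‖ ≤ ‖T S s‖) :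
    NormBound 0 T' (Real.exp (-(K * M)) * c) := fun i => by
  refine (siteSum_mono (w' := fun p => Real.exp (-(K * M)) *
    (Real.exp (K * (p.1.card : ℝ)) * ‖T p.1 p.2‖)) (fun p => ?_) i).trans ?_
  · by_cases h0 : T' p.1 p.2 = 0
    · rw [h0, norm_zero, mul_zero]
      positivity
    · rw [← mul_assoc, ← Real.exp_add, zero_mul, Real.exp_zero]
      gcongr
      · refine Real.one_le_exp ?_
        have := mul_le_mul_of_nonneg_left (hT _ _ h0) hK
        linarith
      · exact hTT _ _
  · rw [siteSum_mul]
    gcongr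
    exact h i

theorem total_add : total (fun S s => T S s + T' S s) = total T + total T' := by
  simp [total, Finset.sum_add_distrib]

theorem total_zero : total (0 : Finset Λ → Finset ι → Op q) = 0 := by simp [total]

theorem total_smul (a : ℂ) : total (fun S s => a • T S s) = a • total T := by
  simp [total, Finset.smul_sum]

theorem total_eq_sum_prod : total T = ∑ p : Finset Λ × Finset ι, T p.1 p.2 := by
  rw [Fintype.sum_prod_type]
  rfl

theorem total_conjTranspose : (total T)ᴴ = total fun S s => (T S s)ᴴ := by
  simp [total, Matrix.conjTranspose_sum]

/-- Averaging a decomposition of a Hermitian operator with its adjoint makes all its terms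
Hermitian. -/
def symmetrize (T : Finset Λ → Finset ι → Op q) : Finset Λ → Finset ι → Op q := fun S s =>
  (1 / 2 : ℂ) • (T S s + (T S s)ᴴ)

theorem symmetrize_isHermitian (S : Finset Λ) (s : Finset ι) :
    (symmetrize T S s).IsHermitian := by
  unfold symmetrize Matrix.IsHermitian
  rw [Matrix.conjTranspose_smul, Matrix.conjTranspose_add, Matrix.conjTranspose_conjTranspose,
    add_comm]
  simp

theorem total_symmetrize (h : (total T).IsHermitian) : total (symmetrize T) = total T := by
  unfold symmetrize
  rw [total_smul, total_add, ← total_conjTranspose, h.eq, ← two_smul ℂ, smul_smul]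
  norm_num

theorem NormBound.symmetrize (h : NormBound K T c) : NormBound K (symmetrize T) c :=
  h.of_norm_le fun S s => by
    unfold FalseVacuum.symmetrize
    rw [norm_smul]
    have := norm_add_le (T S s) (T S s)ᴴ
    rw [Matrix.l2_opNorm_conjTranspose] at this
    norm_num
    linarith

theorem isLocalDecomposition_symmetrize (h : C.IsLocalDecomposition T) :
    C.IsLocalDecomposition (symmetrize T) := fun S s =>
  (termSpace C S s).smul_mem _ ((termSpace C S s).add_mem (h S s)
    (conjTranspose_mem_termSpace (h S s)))

theorem isLocalDecomposition_add (h : C.IsLocalDecomposition T) (h' : C.IsLocalDecomposition T') :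
    C.IsLocalDecomposition (fun S s => T S s + T' S s) := fun S s =>
  (termSpace C S s).add_mem (h S s) (h' S s)

theorem isLocalDecomposition_zero : C.IsLocalDecomposition 0 := fun S s =>
  (termSpace C S s).zero_mem

end Decomposition

/-! ### Commutators of local decompositions -/

section Bracket

variable {Λ : Type*} [Fintype Λ] [DecidableEq Λ] {G : SimpleGraph Λ} {q : Λ → ℕ}
  {ι : Type*} [Fintype ι] [DecidableEq ι] {C : CommutingProjectors G q ι}
  {B A : Finset Λ → Finset ι → Op q} {K a a' b b' : ℝ}

/-- The decomposition of the commutator of `B` and `A`: the commutator of a term supported on `X`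
and a term supported on `S` counts as a term supported on `X ∪ S`. -/
def bracket (B A : Finset Λ → Finset ι → Op q) : Finset Λ → Finset ι → Op q := fun S s =>
  ∑ j : (Finset Λ × Finset ι) × (Finset Λ × Finset ι),
    if j.1.1 ∪ j.2.1 = S ∧ symmDiff j.1.2 j.2.2 = s then
      B j.1.1 j.1.2 * A j.2.1 j.2.2 - A j.2.1 j.2.2 * B j.1.1 j.1.2 else 0

theorem total_bracket : total (bracket B A) = total B * total A - total A * total B := by
  rw [total_eq_sum_prod]
  unfold bracket
  rw [Finset.sum_comm]
  have h : ∀ j : (Finset Λ × Finset ι) × (Finset Λ × Finset ι),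
      (∑ p : Finset Λ × Finset ι, if j.1.1 ∪ j.2.1 = p.1 ∧ symmDiff j.1.2 j.2.2 = p.2 then
        B j.1.1 j.1.2 * A j.2.1 j.2.2 - A j.2.1 j.2.2 * B j.1.1 j.1.2 else 0) =
      B j.1.1 j.1.2 * A j.2.1 j.2.2 - A j.2.1 j.2.2 * B j.1.1 j.1.2 := fun j => by
    rw [Finset.sum_eq_single (j.1.1 ∪ j.2.1, symmDiff j.1.2 j.2.2)]
    · simp
    · rintro p - hp
      rw [if_neg]
      rintro ⟨h1, h2⟩
      exact hp (Prod.ext h1.symm h2.symm)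
    · simp
  simp_rw [h]
  rw [Finset.sum_sub_distrib, total_eq_sum_prod, total_eq_sum_prod, Finset.sum_mul_sum,
    Finset.sum_mul_sum, ← Fintype.sum_prod_type', ← Fintype.sum_prod_type']
  congr 1
  exact (Equiv.prodComm _ _).sum_comp fun j : (Finset Λ × Finset ι) × (Finset Λ × Finset ι) =>
    A j.1.1 j.1.2 * B j.2.1 j.2.2

theorem connectedSet_union {S T : Finset Λ} (hS : ConnectedSet G S) (hT : ConnectedSet G T)
    (h : ¬ Disjoint S T) : ConnectedSet G (S ∪ T) := by
  unfold ConnectedSet at *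
  rw [Finset.coe_union]
  refine SimpleGraph.induce_union_connected hS.preconnected hT.preconnected ?_
  rw [← Finset.coe_inter, Finset.coe_nonempty]
  exact Finset.not_disjoint_iff_nonempty_inter.1 h

theorem isLocalDecomposition_bracket (hB : C.IsLocalDecomposition B)
    (hA : C.IsLocalDecomposition A) : C.IsLocalDecomposition (bracket B A) := by
  rw [isLocalDecomposition_iff]
  intro S s
  refine Submodule.sum_mem _ fun j _ => ?_
  split_ifs with h
  swap
  · exact Submodule.zero_mem _
  obtain ⟨rfl, rfl⟩ := h
  obtain ⟨hB1, hB2, hB3⟩ := hB j.1.1 j.1.2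
  obtain ⟨hA1, hA2, hA3⟩ := hA j.2.1 j.2.2
  refine ⟨?_, ?_, fun hne => ?_⟩
  · exact ((hB1.mono subset_union_left).mul (hA1.mono subset_union_right)).sub
      ((hA1.mono subset_union_right).mul (hB1.mono subset_union_left))
  · refine (hB2.mul hA2).sub ?_
    rw [symmDiff_comm]
    exact hA2.mul hB2
  · have hd : ¬ Disjoint j.1.1 j.2.1 := fun hd => hne (sub_eq_zero.2 (hB1.commute hA1 hd))
    have hB0 : B j.1.1 j.1.2 ≠ 0 := fun h0 => hne (by simp [h0])
    have hA0 : A j.2.1 j.2.2 ≠ 0 := fun h0 => hne (by simp [h0])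
    refine ⟨connectedSet_union (hB3 hB0).1 (hA3 hA0).1 hd, fun f hf => ?_⟩
    rcases Finset.mem_symmDiff.1 hf with ⟨h1, _⟩ | ⟨h1, _⟩
    · exact ((hB3 hB0).2 f h1).trans subset_union_left
    · exact ((hA3 hA0).2 f h1).trans subset_union_right

/-- Counting pairs of overlapping sets: a pair `(X, S)` with `i ∈ X` is charged to the points of
`X`, and a pair with `i ∈ S` to the points of `F S ⊆ S`. -/
theorem sum_overlap_le {u v : Finset Λ × Finset ι → ℝ} {F : Finset Λ × Finset ι → Finset Λ}
    {w : (Finset Λ × Finset ι) × (Finset Λ × Finset ι) → ℝ} (hu : ∀ p, 0 ≤ u p) (hv : ∀ p, 0 ≤ v p)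
    (hF : ∀ p, F p ⊆ p.1) (hw : ∀ j, w j ≤ u j.1 * v j.2)
    (hw0 : ∀ j, Disjoint j.1.1 (F j.2) → w j = 0) (i : Λ)
    (hua : siteSum (fun p => (p.1.card : ℝ) * u p) i ≤ b') (hub : ∀ x, siteSum u x ≤ b)
    (hva : siteSum (fun p => ((F p).card : ℝ) * v p) i ≤ a') (hvb : ∀ x, siteSum v x ≤ a) :
    ∑ j, (if i ∈ j.1.1 ∪ j.2.1 then w j else 0) ≤ b' * a + a' * b := by
  have ha : 0 ≤ a := (siteSum_nonneg hv i).trans (hvb i)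
  have hb : 0 ≤ b := (siteSum_nonneg hu i).trans (hub i)
  have h1 : ∀ j : (Finset Λ × Finset ι) × (Finset Λ × Finset ι),
      (if i ∈ j.1.1 ∪ j.2.1 then w j else 0) ≤
        (if i ∈ j.1.1 then u j.1 * ∑ x ∈ j.1.1, (if x ∈ j.2.1 then v j.2 else 0) else 0) +
        (if i ∈ j.2.1 then v j.2 * ∑ x ∈ F j.2, (if x ∈ j.1.1 then u j.1 else 0) else 0) := by
    intro j
    have hn1 : 0 ≤ (if i ∈ j.1.1 then u j.1 * ∑ x ∈ j.1.1, (if x ∈ j.2.1 then v j.2 else 0)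
        else 0) := by
      split_ifs
      · exact mul_nonneg (hu _) (Finset.sum_nonneg fun x _ => by split_ifs <;> simp [hv])
      · rfl
    have hn2 : 0 ≤ (if i ∈ j.2.1 then v j.2 * ∑ x ∈ F j.2, (if x ∈ j.1.1 then u j.1 else 0)
        else 0) := by
      split_ifs
      · exact mul_nonneg (hv _) (Finset.sum_nonneg fun x _ => by split_ifs <;> simp [hu])
      · rfl
    by_cases hd : Disjoint j.1.1 (F j.2)
    · rw [hw0 j hd, ite_self]
      exact add_nonneg hn1 hn2
    · obtain ⟨x, hx1, hx2⟩ := Finset.not_disjoint_iff.1 hd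
      have hs1 : v j.2 ≤ ∑ x ∈ j.1.1, (if x ∈ j.2.1 then v j.2 else 0) := by
        refine le_trans ?_ (Finset.single_le_sum (fun y _ => ?_) hx1)
        · rw [if_pos (hF _ hx2)]
        · split_ifs <;> simp [hv]
      have hs2 : u j.1 ≤ ∑ x ∈ F j.2, (if x ∈ j.1.1 then u j.1 else 0) := by
        refine le_trans ?_ (Finset.single_le_sum (fun y _ => ?_) hx2)
        · rw [if_pos hx1]
        · split_ifs <;> simp [hu]
      by_cases hi : i ∈ j.1.1 ∪ j.2.1
      · rw [if_pos hi]
        rcases Finset.mem_union.1 hi with h | h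
        · refine (hw j).trans (le_trans ?_ (le_add_of_nonneg_right hn2))
          rw [if_pos h]
          exact mul_le_mul_of_nonneg_left hs1 (hu _)
        · refine (hw j).trans (le_trans ?_ (le_add_of_nonneg_left hn1))
          rw [if_pos h, mul_comm]
          exact mul_le_mul_of_nonneg_left hs2 (hv _)
      · rw [if_neg hi]
        exact add_nonneg hn1 hn2
  refine (Finset.sum_le_sum fun j _ => h1 j).trans ?_
  rw [Finset.sum_add_distrib]
  refine add_le_add ?_ ?_
  · rw [Fintype.sum_prod_type]
    refine le_trans ?_ (mul_le_mul_of_nonneg_right hua ha)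
    unfold siteSum
    rw [Finset.sum_mul]
    refine Finset.sum_le_sum fun p _ => ?_
    dsimp only
    split_ifs with h
    · rw [← Finset.mul_sum, Finset.sum_comm, mul_comm (p.1.card : ℝ), mul_assoc]
      refine mul_le_mul_of_nonneg_left ?_ (hu p)
      rw [← nsmul_eq_mul]
      exact Finset.sum_le_card_nsmul _ _ _ fun x _ => hvb x
    · simp
  · rw [Fintype.sum_prod_type, Finset.sum_comm]
    refine le_trans ?_ (mul_le_mul_of_nonneg_right hva hb)
    unfold siteSum
    rw [Finset.sum_mul]
    refine Finset.sum_le_sum fun p _ => ?_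
    dsimp only
    split_ifs with h
    · rw [← Finset.mul_sum, Finset.sum_comm, mul_comm ((F p).card : ℝ), mul_assoc]
      refine mul_le_mul_of_nonneg_left ?_ (hv p)
      rw [← nsmul_eq_mul]
      exact Finset.sum_le_card_nsmul _ _ _ fun x _ => hub x
    · simp

/-- The norm of a commutator. If the terms of `A` act only on the subsets `F` of their supports,
the number of terms of `B` that matter is controlled by the size of `F`. -/
theorem normBound_bracket (hK : 0 ≤ K) (F : Finset Λ × Finset ι → Finset Λ) (hF : ∀ p, F p ⊆ p.1)
    (hBs : ∀ S s, SupportedOn S (B S s)) (hAs : ∀ p, SupportedOn (F p) (A p.1 p.2))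
    (hB : NormBound K B b) (hA : NormBound K A a)
    (hB' : ∀ i, siteSum (fun p => (p.1.card : ℝ) * (Real.exp (K * (p.1.card : ℝ)) * ‖B p.1 p.2‖)) i
      ≤ b')
    (hA' : ∀ i, siteSum (fun p => ((F p).card : ℝ) * (Real.exp (K * (p.1.card : ℝ)) * ‖A p.1 p.2‖))
      i ≤ a') : NormBound K (bracket B A) (2 * (b' * a + a' * b)) := by
  intro i
  let w : (Finset Λ × Finset ι) × (Finset Λ × Finset ι) → ℝ := fun j =>
    Real.exp (K * ((j.1.1 ∪ j.2.1).card : ℝ)) *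
      ‖B j.1.1 j.1.2 * A j.2.1 j.2.2 - A j.2.1 j.2.2 * B j.1.1 j.1.2‖
  have h1 : siteSum (fun p => Real.exp (K * (p.1.card : ℝ)) * ‖bracket B A p.1 p.2‖) i ≤
      ∑ j, if i ∈ j.1.1 ∪ j.2.1 then w j else 0 := by
    unfold siteSum
    have h2 : ∀ p : Finset Λ × Finset ι,
        (if i ∈ p.1 then Real.exp (K * (p.1.card : ℝ)) * ‖bracket B A p.1 p.2‖ else 0) ≤
        ∑ j : (Finset Λ × Finset ι) × (Finset Λ × Finset ι),
          if j.1.1 ∪ j.2.1 = p.1 ∧ symmDiff j.1.2 j.2.2 = p.2 then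
            (if i ∈ j.1.1 ∪ j.2.1 then w j else 0) else 0 := by
      intro p
      by_cases hi : i ∈ p.1
      · rw [if_pos hi]
        unfold bracket
        refine (mul_le_mul_of_nonneg_left (norm_sum_le _ _) (Real.exp_pos _).le).trans ?_
        rw [Finset.mul_sum]
        refine Finset.sum_le_sum fun j _ => ?_
        by_cases hj : j.1.1 ∪ j.2.1 = p.1 ∧ symmDiff j.1.2 j.2.2 = p.2
        · rw [if_pos hj, if_pos hj, if_pos (hj.1 ▸ hi)]
          simp only [w, hj.1, le_refl]
        · rw [if_neg hj, if_neg hj, norm_zero, mul_zero]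
      · rw [if_neg hi]
        refine Finset.sum_nonneg fun j _ => ?_
        split_ifs <;> positivity
    refine (Finset.sum_le_sum fun p _ => h2 p).trans ?_
    rw [Finset.sum_comm]
    refine Finset.sum_le_sum fun j _ => ?_
    rw [Finset.sum_eq_single (j.1.1 ∪ j.2.1, symmDiff j.1.2 j.2.2)]
    · simp
    · rintro p - hp
      rw [if_neg]
      rintro ⟨h1, h2⟩
      exact hp (Prod.ext h1.symm h2.symm)
    · simp
  refine h1.trans ((sum_overlap_le (b' := 2 * b') (b := 2 * b) (a := a) (a' := a')
    (u := fun p => 2 * (Real.exp (K * (p.1.card : ℝ)) * ‖B p.1 p.2‖))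
    (v := fun p => Real.exp (K * (p.1.card : ℝ)) * ‖A p.1 p.2‖) (F := F) (fun p => by positivity)
    (fun p => by positivity) hF (fun j => ?_) (fun j hj => ?_) i ?_ (fun x => ?_) (hA' i)
    hA).trans_eq (by ring))
  · have hcard : ((j.1.1 ∪ j.2.1).card : ℝ) ≤ j.1.1.card + j.2.1.card := by
      exact_mod_cast Finset.card_union_le _ _
    have hexp : Real.exp (K * ((j.1.1 ∪ j.2.1).card : ℝ)) ≤
        Real.exp (K * (j.1.1.card : ℝ)) * Real.exp (K * (j.2.1.card : ℝ)) := by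
      rw [← Real.exp_add, ← mul_add]
      gcongr
    have hn : ‖B j.1.1 j.1.2 * A j.2.1 j.2.2 - A j.2.1 j.2.2 * B j.1.1 j.1.2‖ ≤
        2 * (‖B j.1.1 j.1.2‖ * ‖A j.2.1 j.2.2‖) := by
      refine (norm_sub_le _ _).trans ?_
      have := norm_mul_le (B j.1.1 j.1.2) (A j.2.1 j.2.2)
      have := norm_mul_le (A j.2.1 j.2.2) (B j.1.1 j.1.2)
      linarith
    calc w j ≤ (Real.exp (K * (j.1.1.card : ℝ)) * Real.exp (K * (j.2.1.card : ℝ))) *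
          (2 * (‖B j.1.1 j.1.2‖ * ‖A j.2.1 j.2.2‖)) := by
          simp only [w]
          gcongr
      _ = _ := by ring
  · simp only [w]
    rw [sub_eq_zero.2 ((hBs _ _).commute (hAs j.2) hj), norm_zero, mul_zero]
  · have : (fun p : Finset Λ × Finset ι => (p.1.card : ℝ) *
        (2 * (Real.exp (K * (p.1.card : ℝ)) * ‖B p.1 p.2‖))) =
        fun p => 2 * ((p.1.card : ℝ) * (Real.exp (K * (p.1.card : ℝ)) * ‖B p.1 p.2‖)) := by
      funext p; ring
    rw [this, siteSum_mul]
    exact mul_le_mul_of_nonneg_left (hB' i) zero_le_two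
  · rw [siteSum_mul]
    exact mul_le_mul_of_nonneg_left (hB x) zero_le_two

/-- The norm of a commutator of arbitrary decompositions, at the price of a smaller exponent. -/
theorem normBound_bracket_of_lt {K' K'' : ℝ} (hK : 0 ≤ K) (hK' : K < K') (hK'' : K' ≤ K'')
    (hBs : ∀ S s, SupportedOn S (B S s)) (hAs : ∀ S s, SupportedOn S (A S s))
    (hB : NormBound K' B b) (hA : NormBound K'' A a) :
    NormBound K (bracket B A) (4 * a / (K' - K) * b) := by
  refine (normBound_bracket hK (fun p => p.1) (fun p => Subset.rfl) hBs (fun p => hAs p.1 p.2)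
    (hB.mono hK'.le le_rfl) (hA.mono (hK'.le.trans hK'') le_rfl)
    (fun i => hB.siteSum_card_le hK' i)
    (fun i => (hA.mono hK'' le_rfl).siteSum_card_le hK' i)).mono le_rfl (le_of_eq ?_)
  ring

end Bracket

/-! ### Conjugation by an exponential -/

section Conjugation

/-- Conjugation by an exponential is the exponential series of the commutator with the generator:
left and right multiplication commute. -/
theorem hasSum_exp_conj {E : Type*} [NormedRing E] [NormedAlgebra ℂ E] [CompleteSpace E]
    (A X : E) : HasSum (fun k : ℕ => ((k.factorial : ℂ)⁻¹) • (fun Y => Y * A - A * Y)^[k] X)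
      (NormedSpace.exp (-A) * X * NormedSpace.exp A) := by
  let L : E →L[ℂ] E := ContinuousLinearMap.mul ℂ E (-A)
  let R : E →L[ℂ] E := (ContinuousLinearMap.mul ℂ E).flip A
  have hL : ∀ Y, L Y = -A * Y := fun Y => rfl
  have hR : ∀ Y, R Y = Y * A := fun Y => rfl
  let _ : NormedAlgebra ℚ (E →L[ℂ] E) := NormedAlgebra.restrictScalars ℚ ℂ _
  have hcomm : Commute L R := by
    ext Y
    simp only [mul_apply_eq_comp, hL, hR, mul_assoc]
  have hpowL : ∀ n Y, (L ^ n) Y = (-A) ^ n * Y := by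
    intro n
    induction n with
    | zero => simp
    | succ n ih => intro Y; rw [pow_succ, mul_apply_eq_comp, ih, hL, ← mul_assoc, ← pow_succ]
  have hpowR : ∀ n Y, (R ^ n) Y = Y * A ^ n := by
    intro n
    induction n with
    | zero => simp
    | succ n ih => intro Y; rw [pow_succ, mul_apply_eq_comp, ih, hR, mul_assoc, ← pow_succ']
  have hpow : ∀ n Y, ((L + R) ^ n) Y = (fun Y => Y * A - A * Y)^[n] Y := by
    intro n
    induction n with
    | zero => simp
    | succ n ih =>
      intro Y
      rw [pow_succ, mul_apply_eq_comp, ih, Function.iterate_succ_apply]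
      congr 1
      rw [_root_.add_apply, hL, hR]
      noncomm_ring
  have happ : ∀ (T : E →L[ℂ] E) (Y : E),
      HasSum (fun k : ℕ => ((k.factorial : ℂ)⁻¹) • (T ^ k) Y) (NormedSpace.exp T Y) := fun T Y =>
    (NormedSpace.exp_series_hasSum_exp' (𝕂 := ℂ) T).mapL (ContinuousLinearMap.apply ℂ E Y)
  have hexpL : ∀ Y, NormedSpace.exp L Y = NormedSpace.exp (-A) * Y := fun Y => by
    refine (happ L Y).unique ?_
    simp_rw [hpowL, ← smul_mul_assoc]
    exact (NormedSpace.exp_series_hasSum_exp' (𝕂 := ℂ) (-A)).mul_right Y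
  have hexpR : ∀ Y, NormedSpace.exp R Y = Y * NormedSpace.exp A := fun Y => by
    refine (happ R Y).unique ?_
    simp_rw [hpowR, ← mul_smul_comm]
    exact (NormedSpace.exp_series_hasSum_exp' (𝕂 := ℂ) A).mul_left Y
  have h := happ (L + R) X
  simp_rw [hpow] at h
  rwa [NormedSpace.exp_add_of_commute hcomm, mul_apply_eq_comp, hexpR, hexpL, ← mul_assoc] at h

end Conjugation

section Series

variable {Λ : Type*} [Fintype Λ] [DecidableEq Λ] {G : SimpleGraph Λ} {q : Λ → ℕ}
  {ι : Type*} [Fintype ι] [DecidableEq ι] {C : CommutingProjectors G q ι}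
  {B A : Finset Λ → Finset ι → Op q} {K h a b : ℝ}

/-- The `k`-fold commutator of `B` with `A`, as a decomposition. -/
def adIter (A B : Finset Λ → Finset ι → Op q) (k : ℕ) : Finset Λ → Finset ι → Op q :=
  (fun T => bracket T A)^[k] B

theorem adIter_succ (k : ℕ) : adIter A B (k + 1) = bracket (adIter A B k) A :=
  Function.iterate_succ_apply' _ _ _

theorem total_adIter (k : ℕ) :
    total (adIter A B k) = (fun Y => Y * total A - total A * Y)^[k] (total B) := by
  induction k with
  | zero => rfl
  | succ k ih => rw [adIter_succ, total_bracket, ih, Function.iterate_succ_apply']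

theorem isLocalDecomposition_adIter (hA : C.IsLocalDecomposition A)
    (hB : C.IsLocalDecomposition B) (k : ℕ) : C.IsLocalDecomposition (adIter A B k) := by
  induction k with
  | zero => exact hB
  | succ k ih => rw [adIter_succ]; exact isLocalDecomposition_bracket ih hA

/-- The `k`-fold commutator costs `k!`, which the exponential series compensates. The loss `h` of
the exponent is divided evenly among the `k` commutators. -/
theorem normBound_adIter [Nonempty Λ] (hA : C.IsLocalDecomposition A)
    (hB : C.IsLocalDecomposition B) (hh : 0 < h) (hK : h ≤ K) (hAn : NormBound K A a)
    (hBn : NormBound K B b) {k : ℕ} (hk : 0 < k) :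
    NormBound (K - h) (adIter A B k) ((k.factorial : ℝ) * ((12 * a / h) ^ k * b)) := by
  have ha := hAn.nonneg
  have hb := hBn.nonneg
  have hk' : (0 : ℝ) < k := by exact_mod_cast hk
  have key : ∀ j ≤ k, NormBound (K - j * (h / k)) (adIter A B j) ((4 * a / (h / k)) ^ j * b) := by
    intro j
    induction j with
    | zero => intro _; simpa [adIter] using hBn
    | succ j ih =>
      intro hj
      rw [adIter_succ]
      have hjk : ((j : ℝ) + 1) * (h / k) ≤ h := by
        rw [mul_div_assoc', div_le_iff₀ hk', mul_comm]
        exact mul_le_mul_of_nonneg_left (by exact_mod_cast hj) hh.le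
      have hpos : 0 < h / k := by positivity
      have hjn : 0 ≤ (j : ℝ) * (h / k) := by positivity
      refine (normBound_bracket_of_lt (K := K - ((j + 1 : ℕ) : ℝ) * (h / k))
        (K' := K - j * (h / k)) (K'' := K) ?_ ?_ ?_
        (fun S s => (isLocalDecomposition_adIter hA hB j S s).1) (fun S s => (hA S s).1)
        (ih (by omega)) hAn).mono le_rfl (le_of_eq ?_)
      · push_cast; linarith
      · push_cast; linarith
      · linarith
      · have : K - j * (h / k) - (K - ((j + 1 : ℕ) : ℝ) * (h / k)) = h / k := by push_cast; ring
        rw [this, pow_succ]; ring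
  refine (key k le_rfl).mono (le_of_eq ?_) ?_
  · field_simp
  · rw [← mul_assoc]
    refine mul_le_mul_of_nonneg_right ?_ hb
    have h1 : (k : ℝ) ^ k ≤ 3 ^ k * k.factorial := by
      have h2 := Real.pow_div_factorial_le_exp k hk'.le k
      rw [div_le_iff₀ (by positivity)] at h2
      refine h2.trans (mul_le_mul_of_nonneg_right ?_ (by positivity))
      rw [← Real.exp_one_pow]
      exact pow_le_pow_left₀ (Real.exp_pos _).le Real.exp_one_lt_three.le k
    have h3 : 4 * a / (h / k) = (4 * a / h) * k := by field_simp
    have h4 : 12 * a / h = (4 * a / h) * 3 := by ring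
    rw [h3, h4, mul_pow, mul_pow]
    calc (4 * a / h) ^ k * (k : ℝ) ^ k ≤ (4 * a / h) ^ k * (3 ^ k * k.factorial) := by gcongr
      _ = _ := by ring

/-- The decomposition of `∑ k, d k • [B, A]_(k + 1)`, for iterated commutators `[B, A]_k`. -/
def adSeries (d : ℕ → ℝ) (A B : Finset Λ → Finset ι → Op q) : Finset Λ → Finset ι → Op q :=
  fun S s => ∑' k, (d k : ℂ) • adIter A B (k + 1) S s

variable {d : ℕ → ℝ}

theorem normBound_adSeries_term [Nonempty Λ] (hA : C.IsLocalDecomposition A)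
    (hB : C.IsLocalDecomposition B) (hh : 0 < h) (hK : h ≤ K) (hAn : NormBound K A a)
    (hBn : NormBound K B b) (hd : ∀ k, |d k| * ((k + 1).factorial : ℝ) ≤ 1) (k : ℕ) :
    NormBound (K - h) (fun S s => (d k : ℂ) • adIter A B (k + 1) S s)
      ((12 * a / h) ^ (k + 1) * b) := by
  have ha := hAn.nonneg
  have hb := hBn.nonneg
  refine ((normBound_adIter hA hB hh hK hAn hBn k.succ_pos).of_norm_le_mul (abs_nonneg (d k))
    fun S s => ?_).mono le_rfl ?_
  · rw [norm_smul, Complex.norm_real, Real.norm_eq_abs]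
  · rw [← mul_assoc]
    exact mul_le_of_le_one_left (by positivity) (hd k)

theorem hasSum_adSeries [Nonempty Λ] (hA : C.IsLocalDecomposition A)
    (hB : C.IsLocalDecomposition B) (hh : 0 < h) (hK : h ≤ K) (hAn : NormBound K A a)
    (hBn : NormBound K B b) (hd : ∀ k, |d k| * ((k + 1).factorial : ℝ) ≤ 1)
    (hx : 12 * a / h < 1) (S : Finset Λ) (s : Finset ι) :
    HasSum (fun k => (d k : ℂ) • adIter A B (k + 1) S s) (adSeries d A B S s) := by
  have ha := hAn.nonneg
  have hb := hBn.nonneg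
  have hx0 : 0 ≤ 12 * a / h := by positivity
  refine Summable.hasSum (Summable.of_norm_bounded
    (g := fun k : ℕ => (12 * a / h) ^ (k + 1) * b) ?_ fun k => ?_)
  · simp_rw [pow_succ, mul_assoc]
    exact (summable_geometric_of_lt_one hx0 hx).mul_right _
  · by_cases hS : S.Nonempty
    · exact (normBound_adSeries_term hA hB hh hK hAn hBn hd k).norm_le (by linarith) hS s
    · have h0 : adIter A B (k + 1) S s = 0 := by
        by_contra h0
        obtain ⟨⟨i, hi⟩⟩ := ((isLocalDecomposition_adIter hA hB (k + 1) S s).2.2 h0).1.nonempty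
        exact hS ⟨i, hi⟩
      rw [h0, smul_zero, norm_zero]
      positivity

theorem isLocalDecomposition_adSeries (hA : C.IsLocalDecomposition A)
    (hB : C.IsLocalDecomposition B) : C.IsLocalDecomposition (adSeries d A B) := by
  rw [isLocalDecomposition_iff]
  intro S s
  by_cases hs : Summable fun k => (d k : ℂ) • adIter A B (k + 1) S s
  · refine (Submodule.closed_of_finiteDimensional (termSpace C S s)).mem_of_tendsto
      hs.hasSum.tendsto_sum_nat (Filter.Eventually.of_forall fun n => ?_)
    exact Submodule.sum_mem _ fun k _ =>
      Submodule.smul_mem _ _ (isLocalDecomposition_adIter hA hB (k + 1) S s)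
  · unfold adSeries
    rw [tsum_eq_zero_of_not_summable hs]
    exact Submodule.zero_mem _

theorem normBound_adSeries [Nonempty Λ] (hA : C.IsLocalDecomposition A)
    (hB : C.IsLocalDecomposition B) (hh : 0 < h) (hK : h ≤ K) (hAn : NormBound K A a)
    (hBn : NormBound K B b) (hd : ∀ k, |d k| * ((k + 1).factorial : ℝ) ≤ 1)
    (hx : 12 * a / h < 1) :
    NormBound (K - h) (adSeries d A B) (12 * a / h / (1 - 12 * a / h) * b) := by
  have ha := hAn.nonneg
  have hb := hBn.nonneg
  set x := 12 * a / h with hxdef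
  have hx0 : 0 ≤ x := by positivity
  have hpart : ∀ n, NormBound (K - h)
      (fun S s => ∑ k ∈ Finset.range n, (d k : ℂ) • adIter A B (k + 1) S s)
      (∑ k ∈ Finset.range n, x ^ (k + 1) * b) := by
    intro n
    induction n with
    | zero =>
      simp only [Finset.range_zero, Finset.sum_empty]
      exact NormBound.zero (K - h)
    | succ n ih =>
      simp_rw [Finset.sum_range_succ]
      exact ih.add (normBound_adSeries_term hA hB hh hK hAn hBn hd n)
  have hle : ∀ n, ∑ k ∈ Finset.range n, x ^ (k + 1) * b ≤ x / (1 - x) * b := by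
    intro n
    rw [← Finset.sum_mul]
    refine mul_le_mul_of_nonneg_right ?_ hb
    have h1 := (summable_geometric_of_lt_one hx0 hx).sum_le_tsum (Finset.range n)
      fun k _ => pow_nonneg hx0 k
    rw [tsum_geometric_of_lt_one hx0 hx] at h1
    simp_rw [pow_succ]
    rw [← Finset.sum_mul, mul_comm, div_eq_mul_inv]
    exact mul_le_mul_of_nonneg_left h1 hx0
  intro i
  refine le_of_tendsto' (x := Filter.atTop)
    (f := fun n => siteSum (fun p => Real.exp ((K - h) * (p.1.card : ℝ)) *
      ‖∑ k ∈ Finset.range n, (d k : ℂ) • adIter A B (k + 1) p.1 p.2‖) i) ?_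
    fun n => ((hpart n).mono le_rfl (hle n)) i
  unfold siteSum
  refine tendsto_finsetSum _ fun p _ => ?_
  split_ifs
  · exact ((hasSum_adSeries hA hB hh hK hAn hBn hd hx p.1 p.2).tendsto_sum_nat.norm).const_mul _
  · exact tendsto_const_nhds

theorem hasSum_total_adSeries [Nonempty Λ] (hA : C.IsLocalDecomposition A)
    (hB : C.IsLocalDecomposition B) (hh : 0 < h) (hK : h ≤ K) (hAn : NormBound K A a)
    (hBn : NormBound K B b) (hd : ∀ k, |d k| * ((k + 1).factorial : ℝ) ≤ 1)
    (hx : 12 * a / h < 1) :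
    HasSum (fun k => (d k : ℂ) • (fun Y => Y * total A - total A * Y)^[k + 1] (total B))
      (total (adSeries d A B)) := by
  simp_rw [← total_adIter, ← total_smul]
  unfold total
  exact hasSum_sum fun S _ => hasSum_sum fun s _ => hasSum_adSeries hA hB hh hK hAn hBn hd hx S s

theorem exp_conj_total [Nonempty Λ] (hA : C.IsLocalDecomposition A)
    (hB : C.IsLocalDecomposition B) (hh : 0 < h) (hK : h ≤ K) (hAn : NormBound K A a)
    (hBn : NormBound K B b) (hx : 12 * a / h < 1) :
    NormedSpace.exp (-total A) * total B * NormedSpace.exp (total A) =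
      total B + total (adSeries (fun k => ((k + 1).factorial : ℝ)⁻¹) A B) := by
  have h1 := hasSum_total_adSeries (d := fun k => ((k + 1).factorial : ℝ)⁻¹) hA hB hh hK hAn hBn
    (fun k => by
      have : (0 : ℝ) < ((k + 1).factorial : ℝ) := by positivity
      rw [abs_of_pos (by positivity), inv_mul_cancel₀ this.ne']) hx
  have h2 := hasSum_exp_conj (total A) (total B)
  rw [← hasSum_nat_add_iff' 1] at h2
  simp only [Finset.range_one, Finset.sum_singleton, Nat.factorial_zero, Nat.cast_one, inv_one,
    one_smul, Function.iterate_zero, id_eq] at h2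
  simp only [Complex.ofReal_inv, Complex.ofReal_natCast] at h1
  rw [h1.unique h2]
  abel

/-- The conjugate of an operator `X` which is not small itself, but whose commutator with the
generator has a small decomposition. -/
theorem exp_conj_of_commutator [Nonempty Λ] (hA : C.IsLocalDecomposition A)
    (hB : C.IsLocalDecomposition B) (hh : 0 < h) (hK : h ≤ K) (hAn : NormBound K A a)
    (hBn : NormBound K B b) (hx : 12 * a / h < 1) (X : Op q)
    (hX : X * total A - total A * X = total B) :
    NormedSpace.exp (-total A) * X * NormedSpace.exp (total A) =
      X + total B + total (adSeries (fun k => ((k + 2).factorial : ℝ)⁻¹) A B) := by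
  have h1 := hasSum_total_adSeries (d := fun k => ((k + 2).factorial : ℝ)⁻¹) hA hB hh hK hAn hBn
    (fun k => by
      have : (0 : ℝ) < ((k + 2).factorial : ℝ) := by positivity
      rw [abs_of_pos (by positivity), inv_mul_le_one₀ this]
      exact_mod_cast Nat.factorial_le (by omega)) hx
  have h2 := hasSum_exp_conj (total A) X
  rw [← hasSum_nat_add_iff' 2] at h2
  simp only [Finset.sum_range_succ, Finset.range_zero, Finset.sum_empty, zero_add,
    Nat.factorial_zero, Nat.factorial_one, Nat.cast_one, inv_one,
    one_smul, Function.iterate_zero, id_eq, Function.iterate_one, hX] at h2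
  have h3 : ∀ k, (fun Y => Y * total A - total A * Y)^[k + 2] X =
      (fun Y => Y * total A - total A * Y)^[k + 1] (total B) := fun k => by
    rw [← hX]
    exact Function.iterate_succ_apply _ _ _
  simp_rw [h3] at h2
  simp only [Complex.ofReal_inv, Complex.ofReal_natCast] at h1
  rw [h1.unique h2]
  abel

end Series

/-! ### Filling the holes of a set of sites -/

section Holes

variable {Λ : Type*} [Fintype Λ] [DecidableEq Λ] {G : SimpleGraph Λ} {d : ℕ} {cd cd' : ℝ}

theorem mem_boundary {S : Finset Λ} {i : Λ} :
    i ∈ boundary G S ↔ i ∈ S ∧ ∃ j, j ∉ S ∧ G.Adj i j := by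
  simp only [boundary, Finset.mem_filter]

theorem diam_le {S : Finset Λ} {n : ℕ} (h : ∀ i ∈ S, ∀ j ∈ S, G.dist i j ≤ n) : diam G S ≤ n :=
  Finset.sup_le fun i hi => Finset.sup_le fun j hj => h i hi j hj

theorem card_le_of_diam_le (hV : VolumeGrowth G d cd) (hcd : 0 < cd) {S : Finset Λ} {n : ℕ}
    (hS : ConnectedSet G S) (h : diam G S ≤ n) : (S.card : ℝ) ≤ cd * (max 1 (n : ℝ)) ^ d := by
  refine (hV S hS).trans ?_
  gcongr

open Classical in
theorem card_neighbors_le (hG : G.Connected) (hV : VolumeGrowth G d cd) (hcd : 0 < cd) (j : Λ) :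
    (((Finset.univ.filter fun i => G.Adj i j).card : ℕ) : ℝ) ≤ cd * 2 ^ d := by
  have hmem : ∀ i ∈ insert j (Finset.univ.filter fun i => G.Adj i j), i = j ∨ G.Adj i j :=
    fun i hi => by simpa using hi
  have hconn : ConnectedSet G (insert j (Finset.univ.filter fun i => G.Adj i j)) := by
    unfold ConnectedSet
    rw [SimpleGraph.connected_iff_exists_forall_reachable]
    refine ⟨⟨j, by simp⟩, fun ⟨i, hi⟩ => ?_⟩
    rcases hmem i hi with rfl | h
    · exact SimpleGraph.Reachable.refl _
    · exact SimpleGraph.Adj.reachable (by simpa using h.symm)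
  have hdist : ∀ i ∈ insert j (Finset.univ.filter fun i => G.Adj i j), G.dist i j ≤ 1 := by
    intro i hi
    rcases hmem i hi with rfl | h
    · simp
    · exact (SimpleGraph.dist_eq_one_iff_adj.2 h).le
  have h2 := card_le_of_diam_le hV hcd hconn (n := 2) (diam_le fun i hi k hk => by
    have h1 := hG.dist_triangle (u := i) (v := j) (w := k)
    have h2 := hdist i hi
    have h3 := hdist k hk
    rw [SimpleGraph.dist_comm] at h3
    omega)
  have h3 : (max 1 ((2 : ℕ) : ℝ)) = 2 := by norm_num
  rw [h3] at h2
  refine le_trans ?_ h2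
  exact Nat.cast_le.2 (Finset.card_le_card (Finset.subset_insert _ _))

open Classical in
/-- Every `F₀ ⊆ S` can be enlarged, by the holes of its complement in `S`, to a set `F` all of
whose complementary components in `S` reach the complement of `S`. The holes are
surrounded by `F₀`. -/
theorem exists_filling (S F₀ : Finset Λ) (hF₀ : F₀ ⊆ S) :
    ∃ F, F₀ ⊆ F ∧ F ⊆ S ∧
      (∀ X : (G.induce ((S \ F : Finset Λ) : Set Λ)).ConnectedComponent,
        ∃ i ∈ X.supp, ∃ j, j ∉ S ∧ G.Adj i.1 j) ∧
      boundary G (F \ F₀) ⊆ F₀.biUnion fun j => Finset.univ.filter fun i => G.Adj i j := by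
  let r : Λ → Λ → Prop := fun i j => G.Adj i j ∧ (i ∈ S ∧ i ∉ F₀) ∧ (j ∈ S ∧ j ∉ F₀)
  let E : Λ → Prop := fun k => (k ∈ S ∧ k ∉ F₀) ∧ ∃ j, j ∉ S ∧ G.Adj k j
  let Y : Finset Λ := (S \ F₀).filter fun i => ∃ k, Relation.ReflTransGen r i k ∧ E k
  have hY : ∀ i, i ∈ Y ↔ (i ∈ S ∧ i ∉ F₀) ∧ ∃ k, Relation.ReflTransGen r i k ∧ E k :=
    fun i => by simp [Y]
  have hSY : ∀ i, i ∈ S \ (S \ Y) ↔ i ∈ Y := fun i => by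
    simp only [Finset.mem_sdiff, not_and, not_not]
    exact ⟨fun h => h.2 h.1, fun h => ⟨((hY i).1 h).1.1, fun _ => h⟩⟩
  have hreach : ∀ k, E k → ∀ i, Relation.ReflTransGen r i k → i ∈ S ∧ i ∉ F₀ →
      ∃ (hi : i ∈ ((S \ (S \ Y) : Finset Λ) : Set Λ)) (hk : k ∈ ((S \ (S \ Y) : Finset Λ) : Set Λ)),
        (G.induce ((S \ (S \ Y) : Finset Λ) : Set Λ)).Reachable ⟨i, hi⟩ ⟨k, hk⟩ := by
    intro k hk i hik
    induction hik using Relation.ReflTransGen.head_induction_on with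
    | refl =>
      intro h
      have hm : k ∈ ((S \ (S \ Y) : Finset Λ) : Set Λ) :=
        Finset.mem_coe.2 ((hSY k).2 ((hY k).2 ⟨h, k, Relation.ReflTransGen.refl, hk⟩))
      exact ⟨hm, hm, SimpleGraph.Reachable.refl _⟩
    | head h1 h2 ih =>
      intro h
      obtain ⟨hc, hk', hr⟩ := ih h1.2.2
      refine ⟨Finset.mem_coe.2 ((hSY _).2 ((hY _).2 ⟨h, k, Relation.ReflTransGen.head h1 h2, hk⟩)),
        hk', SimpleGraph.Reachable.trans (SimpleGraph.Adj.reachable ?_) hr⟩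
      simpa using h1.1
  refine ⟨S \ Y, fun i hi => Finset.mem_sdiff.2 ⟨hF₀ hi, fun h => ((hY i).1 h).1.2 hi⟩,
    Finset.sdiff_subset, fun X => ?_, fun i hi => ?_⟩
  · induction X using SimpleGraph.ConnectedComponent.ind with
    | h v =>
      obtain ⟨i, hi⟩ := v
      obtain ⟨hi1, k, hik, hk⟩ := (hY i).1 ((hSY i).1 (Finset.mem_coe.1 hi))
      obtain ⟨_, hk', hr⟩ := hreach k hk i hik hi1
      exact ⟨⟨k, hk'⟩, SimpleGraph.ConnectedComponent.sound hr.symm, hk.2⟩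
  · have hi' : i ∈ (S \ Y) \ F₀ ∧ ∃ j, j ∉ (S \ Y) \ F₀ ∧ G.Adj i j :=
      mem_boundary.1 hi
    obtain ⟨hi, j, hj, hij⟩ := hi'
    obtain ⟨hi, hi0⟩ := Finset.mem_sdiff.1 hi
    obtain ⟨hiS, hiY⟩ := Finset.mem_sdiff.1 hi
    rw [hY] at hiY
    -- A neighbour of a hole which is not itself in a hole and not in `F₀` would connect the hole to
    -- the complement of `S`.
    have hjS : j ∈ S := by
      by_contra hjS
      exact hiY ⟨⟨hiS, hi0⟩, i, Relation.ReflTransGen.refl, ⟨hiS, hi0⟩, j, hjS, hij⟩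
    have hj0 : j ∈ F₀ := by
      by_contra hj0
      have hjY : j ∈ Y := by
        by_contra hjY
        exact hj (Finset.mem_sdiff.2 ⟨Finset.mem_sdiff.2 ⟨hjS, hjY⟩, hj0⟩)
      obtain ⟨_, k, hk, hk'⟩ := (hY j).1 hjY
      exact hiY ⟨⟨hiS, hi0⟩, k, Relation.ReflTransGen.head ⟨hij, ⟨hiS, hi0⟩, hjS, hj0⟩ hk, hk'⟩
    exact Finset.mem_biUnion.2 ⟨j, hj0, by simpa using hij⟩

/-- By the isoperimetric inequality, the filling of `F₀` in a set of at most `r ^ d` sites has at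
most of order `r |F₀|` sites. -/
theorem exists_filling_card_le (hd : 1 ≤ d) (hcd : 0 < cd) (hcd' : 0 < cd') (hG : G.Connected)
    (hV : VolumeGrowth G d cd) {M r : ℝ} (hiso : Isoperimetric G d cd' M) (hr : 0 ≤ r)
    (S F₀ : Finset Λ) (hF₀ : F₀ ⊆ S) (hSM : (S.card : ℝ) ≤ M) (hSr : (S.card : ℝ) ≤ r ^ d) :
    ∃ F, F₀ ⊆ F ∧ F ⊆ S ∧
      (∀ X : (G.induce ((S \ F : Finset Λ) : Set Λ)).ConnectedComponent,
        ∃ i ∈ X.supp, ∃ j, j ∉ S ∧ G.Adj i.1 j) ∧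
      (F.card : ℝ) ≤ F₀.card * (1 + cd * 2 ^ d * r / cd') := by
  classical
  obtain ⟨F, h1, h2, h3, h4⟩ := exists_filling (G := G) S F₀ hF₀
  refine ⟨F, h1, h2, h3, ?_⟩
  have hcard : (F.card : ℝ) = F₀.card + (F \ F₀).card := by
    rw [← Finset.card_sdiff_add_card_eq_card h1]
    push_cast
    ring
  have hb : ((boundary G (F \ F₀)).card : ℝ) ≤ F₀.card * (cd * 2 ^ d) := by
    have h5 : ((boundary G (F \ F₀)).card : ℝ) ≤
        ((F₀.biUnion fun j => Finset.univ.filter fun i => G.Adj i j).card : ℝ) := by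
      exact_mod_cast Finset.card_le_card h4
    refine h5.trans ?_
    have h6 : ((F₀.biUnion fun j => Finset.univ.filter fun i => G.Adj i j).card : ℝ) ≤
        ∑ j ∈ F₀, ((Finset.univ.filter fun i => G.Adj i j).card : ℝ) := by
      exact_mod_cast Finset.card_biUnion_le
    refine h6.trans ?_
    rw [← nsmul_eq_mul]
    exact Finset.sum_le_card_nsmul _ _ _ fun j _ => card_neighbors_le hG hV hcd j
  rcases (F \ F₀).eq_empty_or_nonempty with h0 | hne
  · rw [hcard, h0, Finset.card_empty, mul_add, mul_one]
    push_cast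
    gcongr
    positivity
  · have hsub : ((F \ F₀).card : ℝ) ≤ S.card := by
      exact_mod_cast Finset.card_le_card (Finset.sdiff_subset.trans h2)
    have hi := hiso _ hne (hsub.trans hSM)
    set x : ℝ := ((F \ F₀).card : ℝ) with hx
    have hx0 : 0 < x := by
      rw [hx]
      exact_mod_cast Finset.card_pos.2 hne
    have hxr : x ^ (1 / (d : ℝ)) ≤ r := by
      have h7 : x ^ (1 / (d : ℝ)) ≤ (r ^ d) ^ (1 / (d : ℝ)) :=
        Real.rpow_le_rpow hx0.le (hsub.trans hSr) (by positivity)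
      rw [one_div, Real.pow_rpow_inv_natCast hr (by omega)] at h7
      rwa [one_div]
    have hsplit : x = x ^ (1 - 1 / (d : ℝ)) * x ^ (1 / (d : ℝ)) := by
      rw [← Real.rpow_add hx0, sub_add_cancel, Real.rpow_one]
    have h8 : x * cd' ≤ F₀.card * (cd * 2 ^ d) * r := by
      calc x * cd' = (cd' * x ^ (1 - 1 / (d : ℝ))) * x ^ (1 / (d : ℝ)) := by
            rw [mul_assoc, ← hsplit, mul_comm]
        _ ≤ F₀.card * (cd * 2 ^ d) * r :=
            mul_le_mul (hi.trans hb) hxr (Real.rpow_nonneg hx0.le _)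
              (mul_nonneg (Nat.cast_nonneg _) (by positivity))
    rw [hcard, mul_add, mul_one]
    gcongr
    rw [mul_div_assoc', le_div_iff₀ hcd']
    linarith

end Holes

/-! ### Solving for the generator of the rotation, term by term -/

section LocalSolution

variable {Λ : Type*} [Fintype Λ] [DecidableEq Λ] {G : SimpleGraph Λ} {q : Λ → ℕ}
  {ι : Type*} [Fintype ι] [DecidableEq ι] {C : CommutingProjectors G q ι}
  {d : ℕ} {cd cd' R' r Δ : ℝ} {ℓ₀ : ℕ} {ψ : Config q → ℂ}

/-- An operator with trivial syndrome and small support has `ψ` as an eigenvector: by the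
isoperimetric inequality, the filling of the empty set is empty, so local nondegeneracy makes the
operator act like a scalar. -/
theorem exists_mulVec_eq_smul (hd : 1 ≤ d) (hcd : 0 < cd) (hcd' : 0 < cd') (hG : G.Connected)
    (hV : VolumeGrowth G d cd) (hiso : Isoperimetric G d cd' (cd * R' ^ d))
    (hnd : C.LocallyNondegenerate d cd R' ψ) {S : Finset Λ} {O : Op q}
    (hO : O ∈ termSpace C S ∅) (hS : (S.card : ℝ) ≤ cd * R' ^ d) :
    ∃ c : ℂ, O.mulVec ψ = c • ψ := by
  by_cases h0 : O = 0
  · exact ⟨0, by simp [h0]⟩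
  obtain ⟨F, -, hFS, hcomp, hcard⟩ := exists_filling_card_le hd hcd hcd' hG hV hiso
    (r := max 1 (S.card : ℝ)) (by positivity) S ∅ (Finset.empty_subset _) hS
    ((le_max_right _ _).trans (le_self_pow₀ (le_max_left _ _) (by omega)))
  have hF : F = ∅ := by
    rw [← Finset.card_eq_zero]
    simp only [Finset.card_empty, Nat.cast_zero, zero_mul] at hcard
    exact_mod_cast le_antisymm hcard (Nat.cast_nonneg _)
  obtain ⟨O', hO', -, -, h⟩ := hnd S F ∅ O (hO.2.2 h0).1 hS hO.1 hO.2.1 (by simp) hFS (by simp)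
    hcomp
  rw [hF] at hO'
  obtain ⟨c, rfl⟩ := hO'.eq_smul_one
  exact ⟨c, by rw [h, Matrix.smul_mulVec, Matrix.one_mulVec]⟩

theorem mulVec_eq_zero_of_blockDiagonal (hψ : C.IsGroundState ψ) {S : Finset Λ} {s : Finset ι}
    {O : Op q} (hO : O ∈ termSpace C S s) (hs : s.Nonempty)
    (hbd : O * C.localProj S = C.localProj S * O) : O.mulVec ψ = 0 := by
  by_cases h0 : O = 0
  · simp [h0]
  obtain ⟨f, hf⟩ := hs
  conv_lhs => rw [← CommutingProjectors.localProj_mulVec hψ S]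
  rw [Matrix.mulVec_mulVec, hbd]
  exact CommutingProjectors.localProj_mulVec_eq_zero hO.2.1 hψ S f hf ((hO.2.2 h0).2 f hf)

/-- The local step. A term `O` with nontrivial syndrome `s` acts on `ψ` like an operator `O'` on
the filling `F` of the violated factors, which creates an energy at least `Δ |s|`. Dividing the
off-diagonal part of `O'` by this energy gives a generator `a` of size `‖O‖ / (Δ |s|)`, whose
commutator with the Hamiltonian cancels the action of `O` on `ψ`. Since `F` has at most of order
`r |s|` sites, `‖a‖ |F|` is bounded independently of `s`. -/
theorem exists_generator (hd : 1 ≤ d) (hcd : 0 < cd) (hcd' : 0 < cd') (hG : G.Connected)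
    (hV : VolumeGrowth G d cd) (hiso : Isoperimetric G d cd' (cd * R' ^ d)) (hr : 0 ≤ r)
    (hΔ : 0 < Δ) (hdiam : ∀ f, diam G (C.supp f) ≤ ℓ₀) (hcoeff : ∀ f, Δ ≤ C.coeff f)
    (hψ : C.IsGroundState ψ) (hnd : C.LocallyNondegenerate d cd R' ψ) {S : Finset Λ}
    {s : Finset ι} {O : Op q} (hO : O ∈ termSpace C S s) (hs : s.Nonempty)
    (hO0 : O ≠ 0) (hSM : (S.card : ℝ) ≤ cd * R' ^ d) (hSr : (S.card : ℝ) ≤ r ^ d) :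
    ∃ (F : Finset Λ) (a g : Op q), F ⊆ S ∧ SupportedOn F a ∧ a ∈ termSpace C S s ∧ aᴴ = -a ∧
      ‖a‖ * Δ ≤ ‖O‖ ∧
      F.card * ‖a‖ * Δ ≤ cd * (max 1 (ℓ₀ : ℝ)) ^ d * (1 + cd * 2 ^ d * r / cd') * ‖O‖ ∧
      g ∈ termSpace C S s ∧ g.IsHermitian ∧ ‖g‖ ≤ ‖O‖ ∧
      C.hamiltonian * a - a * C.hamiltonian = g ∧ (O + g).mulVec ψ = 0 := by
  obtain ⟨hOS, hOs, hO'⟩ := hO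
  obtain ⟨hSconn, hsS⟩ := hO' hO0
  obtain ⟨F, hF0, hFS, hcomp, hcard⟩ := exists_filling_card_le hd hcd hcd' hG hV hiso hr S
    (s.biUnion C.supp) (Finset.biUnion_subset.2 hsS) hSM hSr
  have hsF : ∀ f ∈ s, C.supp f ⊆ F := fun f hf => (Finset.subset_biUnion_of_mem C.supp hf).trans hF0
  obtain ⟨f₀, hf₀⟩ := hs
  obtain ⟨X, hXF, hXs, hXn, hX⟩ := hnd S F s O hSconn hSM hOS hOs hsS hFS (fun f hf => by
    rw [Finset.inter_eq_left.2 (hsF f hf)]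
    obtain ⟨⟨i, hi⟩⟩ := (C.supp_connected f).nonempty
    exact ⟨i, hi⟩) hcomp
  set P := C.localProj F with hPdef
  set E : ℝ := ∑ f ∈ s, C.coeff f with hEdef
  have hP : P.IsHermitian := CommutingProjectors.localProj_hermitian (C := C) F
  have hPs : C.HasSyndrome ∅ P := CommutingProjectors.localProj_hasSyndrome (C := C) F
  have hPF : SupportedOn F P := CommutingProjectors.localProj_supported (C := C) F
  have hE : Δ * s.card ≤ E := by
    rw [mul_comm, ← nsmul_eq_mul]
    exact Finset.card_nsmul_le_sum _ _ _ fun f _ => hcoeff f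
  have hs1 : (1 : ℝ) ≤ s.card := by exact_mod_cast Finset.card_pos.2 ⟨f₀, hf₀⟩
  have hEΔ : Δ ≤ E := (le_mul_of_one_le_right hΔ.le hs1).trans hE
  have hE0 : 0 < E := hΔ.trans_le hEΔ
  have hPXP : P * X * P = 0 :=
    CommutingProjectors.localProj_mul_mul_localProj hXs F f₀ hf₀ (hsF f₀ hf₀)
  have hcom : C.hamiltonian * (X * P) - X * P * C.hamiltonian = (E : ℂ) • (X * P) :=
    CommutingProjectors.hamiltonian_commutator hXs F hsF
  have hcom' := congrArg Matrix.conjTranspose hcom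
  rw [Matrix.conjTranspose_sub, Matrix.conjTranspose_mul, Matrix.conjTranspose_mul,
    Matrix.conjTranspose_mul, Matrix.conjTranspose_smul, Matrix.conjTranspose_mul, hP.eq,
    CommutingProjectors.hamiltonian_isHermitian.eq, Complex.star_def, Complex.conj_ofReal] at hcom'
  have hXP : SupportedOn F (X * P) := hXF.mul hPF
  have hPX : SupportedOn F (P * Xᴴ) := hPF.mul hXF.conjTranspose
  have hXPs : C.HasSyndrome s (X * P) := by
    have h := hXs.mul hPs
    rwa [← Finset.bot_eq_empty, symmDiff_bot] at h
  have hPXs : C.HasSyndrome s (P * Xᴴ) := by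
    have h := hPs.mul hXs.conjTranspose
    rwa [← Finset.bot_eq_empty, bot_symmDiff] at h
  have hnorm : ∀ c : ℂ, ‖c‖ = 1 → ‖X * P + c • (P * Xᴴ)‖ ≤ ‖O‖ := fun c hc =>
    (norm_mul_proj_add_le_matrix hP (CommutingProjectors.localProj_mul_self F) hPXP c hc).trans hXn
  have hadj : (X * P)ᴴ = P * Xᴴ := by rw [Matrix.conjTranspose_mul, hP.eq]
  have hadj' : (P * Xᴴ)ᴴ = X * P := by
    rw [Matrix.conjTranspose_mul, hP.eq, Matrix.conjTranspose_conjTranspose]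
  set a : Op q := (-(E : ℂ)⁻¹) • (X * P + (-1 : ℂ) • (P * Xᴴ)) with hadef
  have haF : SupportedOn F a := (hXP.add (hPX.smul _)).smul _
  have hanorm : ‖a‖ * E ≤ ‖O‖ := by
    rw [hadef, norm_smul, norm_neg, norm_inv, Complex.norm_real, Real.norm_eq_abs, abs_of_pos hE0,
      mul_comm, ← mul_assoc, mul_inv_cancel₀ hE0.ne', one_mul]
    exact hnorm (-1) (by simp)
  refine ⟨F, a, -(X * P + (1 : ℂ) • (P * Xᴴ)), hFS, haF, ⟨haF.mono hFS,
    (hXPs.add (hPXs.smul _)).smul _, fun _ => ⟨hSconn, hsS⟩⟩, ?_, ?_, ?_, ⟨?_, ?_,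
    fun _ => ⟨hSconn, hsS⟩⟩, ?_, ?_, ?_, ?_⟩
  · rw [hadef, Matrix.conjTranspose_smul, Matrix.conjTranspose_add, Matrix.conjTranspose_smul, hadj,
      hadj']
    simp only [star_neg, star_inv₀, Complex.star_def, Complex.conj_ofReal, star_one, neg_smul,
      one_smul, smul_add, smul_neg, neg_add, neg_neg]
    exact add_comm _ _
  · exact (mul_le_mul_of_nonneg_left hEΔ (norm_nonneg _)).trans hanorm
  · have hF0card : ((s.biUnion C.supp).card : ℝ) ≤ s.card * (cd * (max 1 (ℓ₀ : ℝ)) ^ d) := by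
      have h6 : ((s.biUnion C.supp).card : ℝ) ≤ ∑ f ∈ s, ((C.supp f).card : ℝ) := by
        exact_mod_cast Finset.card_biUnion_le
      refine h6.trans ?_
      rw [← nsmul_eq_mul]
      exact Finset.sum_le_card_nsmul _ _ _ fun f _ =>
        card_le_of_diam_le hV hcd (C.supp_connected f) (hdiam f)
    have hB : 0 ≤ 1 + cd * 2 ^ d * r / cd' := by positivity
    calc (F.card : ℝ) * ‖a‖ * Δ
        ≤ (s.card * (cd * (max 1 (ℓ₀ : ℝ)) ^ d) * (1 + cd * 2 ^ d * r / cd')) * ‖a‖ * Δ := by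
          have := hcard.trans (mul_le_mul_of_nonneg_right hF0card hB)
          gcongr
      _ = cd * (max 1 (ℓ₀ : ℝ)) ^ d * (1 + cd * 2 ^ d * r / cd') * (‖a‖ * (Δ * s.card)) := by
          ring
      _ ≤ _ := by
          have := (mul_le_mul_of_nonneg_left hE (norm_nonneg a)).trans hanorm
          gcongr
  · exact ((hXP.add (hPX.smul _)).neg).mono hFS
  · exact (hXPs.add (hPXs.smul _)).neg
  · unfold Matrix.IsHermitian
    rw [one_smul, Matrix.conjTranspose_neg, Matrix.conjTranspose_add, hadj, hadj', add_comm]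
  · rw [norm_neg]
    exact hnorm 1 (by simp)
  · have hE' : (E : ℂ) ≠ 0 := by exact_mod_cast hE0.ne'
    have e1 : C.hamiltonian * (X * P) = X * P * C.hamiltonian + (E : ℂ) • (X * P) := by
      rw [← hcom]; abel
    have e2 : C.hamiltonian * (P * Xᴴ) = P * Xᴴ * C.hamiltonian - (E : ℂ) • (P * Xᴴ) := by
      rw [← hcom']; abel
    rw [hadef, mul_smul_comm, smul_mul_assoc, mul_add, add_mul, mul_smul_comm, smul_mul_assoc, e1,
      e2, ← smul_sub]
    have : X * P * C.hamiltonian + (E : ℂ) • (X * P) +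
        (-1 : ℂ) • (P * Xᴴ * C.hamiltonian - (E : ℂ) • (P * Xᴴ)) -
        (X * P * C.hamiltonian + (-1 : ℂ) • (P * Xᴴ * C.hamiltonian)) =
        (E : ℂ) • (X * P + (1 : ℂ) • (P * Xᴴ)) := by
      rw [neg_smul, neg_smul, one_smul, one_smul, one_smul, smul_add]
      abel
    rw [this, smul_smul, neg_mul, inv_mul_cancel₀ hE', neg_smul, one_smul]
  · rw [Matrix.add_mulVec, Matrix.neg_mulVec, Matrix.add_mulVec, one_smul, hX,
      ← Matrix.mulVec_mulVec, CommutingProjectors.localProj_mulVec hψ,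
      CommutingProjectors.localProj_mulVec_eq_zero hXs.conjTranspose hψ F f₀ hf₀ (hsF f₀ hf₀)]
    simp

/-- Solving for the generator in all terms supported on at most `r ^ d` sites: afterwards, these
terms have `ψ` as an eigenvector. -/
theorem exists_generator_family (hd : 1 ≤ d) (hcd : 0 < cd) (hcd' : 0 < cd') (hG : G.Connected)
    (hV : VolumeGrowth G d cd) (hiso : Isoperimetric G d cd' (cd * R' ^ d)) (hr : 0 ≤ r)
    (hΔ : 0 < Δ) (hdiam : ∀ f, diam G (C.supp f) ≤ ℓ₀) (hcoeff : ∀ f, Δ ≤ C.coeff f)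
    (hψ : C.IsGroundState ψ) (hnd : C.LocallyNondegenerate d cd R' ψ)
    (hrM : r ^ d ≤ cd * R' ^ d) {V : Finset Λ → Finset ι → Op q} (hVl : C.IsLocalDecomposition V) :
    ∃ (F : Finset Λ × Finset ι → Finset Λ) (A g : Finset Λ → Finset ι → Op q),
      (∀ p, F p ⊆ p.1) ∧ (∀ p, SupportedOn (F p) (A p.1 p.2)) ∧ C.IsLocalDecomposition A ∧
      (∀ S s, (A S s)ᴴ = -A S s) ∧ (∀ S s, ‖A S s‖ * Δ ≤ ‖V S s‖) ∧
      (∀ p, (F p).card * ‖A p.1 p.2‖ * Δ ≤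
        cd * (max 1 (ℓ₀ : ℝ)) ^ d * (1 + cd * 2 ^ d * r / cd') * ‖V p.1 p.2‖) ∧
      C.IsLocalDecomposition g ∧ (∀ S s, (g S s).IsHermitian) ∧ (∀ S s, ‖g S s‖ ≤ ‖V S s‖) ∧
      C.hamiltonian * total A - total A * C.hamiltonian = total g ∧
      ∀ (S : Finset Λ) s, (S.card : ℝ) ≤ r ^ d → ∃ c : ℂ, (V S s + g S s).mulVec ψ = c • ψ := by
  have key : ∀ p : Finset Λ × Finset ι, ∃ (F : Finset Λ) (a g : Op q), F ⊆ p.1 ∧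
      SupportedOn F a ∧ a ∈ termSpace C p.1 p.2 ∧ aᴴ = -a ∧ ‖a‖ * Δ ≤ ‖V p.1 p.2‖ ∧
      F.card * ‖a‖ * Δ ≤
        cd * (max 1 (ℓ₀ : ℝ)) ^ d * (1 + cd * 2 ^ d * r / cd') * ‖V p.1 p.2‖ ∧
      g ∈ termSpace C p.1 p.2 ∧ g.IsHermitian ∧ ‖g‖ ≤ ‖V p.1 p.2‖ ∧
      C.hamiltonian * a - a * C.hamiltonian = g ∧
      ((p.1.card : ℝ) ≤ r ^ d → ∃ c : ℂ, (V p.1 p.2 + g).mulVec ψ = c • ψ) := by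
    rintro ⟨S, s⟩
    have trivial_solution : ((S.card : ℝ) ≤ r ^ d → ∃ c : ℂ, (V S s).mulVec ψ = c • ψ) →
        ∃ (F : Finset Λ) (a g : Op q), F ⊆ S ∧
        SupportedOn F a ∧ a ∈ termSpace C S s ∧ aᴴ = -a ∧ ‖a‖ * Δ ≤ ‖V S s‖ ∧
        F.card * ‖a‖ * Δ ≤
          cd * (max 1 (ℓ₀ : ℝ)) ^ d * (1 + cd * 2 ^ d * r / cd') * ‖V S s‖ ∧
        g ∈ termSpace C S s ∧ g.IsHermitian ∧ ‖g‖ ≤ ‖V S s‖ ∧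
        C.hamiltonian * a - a * C.hamiltonian = g ∧
        ((S.card : ℝ) ≤ r ^ d → ∃ c : ℂ, (V S s + g).mulVec ψ = c • ψ) := fun h =>
      ⟨∅, 0, 0, Finset.empty_subset _, SupportedOn.zero _, Submodule.zero_mem _, by simp,
        by simp, by simp; positivity, Submodule.zero_mem _, Matrix.isHermitian_zero, by simp,
        by simp, by simpa using h⟩
    by_cases hSr : (S.card : ℝ) ≤ r ^ d
    · by_cases h0 : V S s = 0
      · exact trivial_solution fun _ => ⟨0, by simp [h0]⟩
      · rcases s.eq_empty_or_nonempty with rfl | hs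
        · exact trivial_solution fun h =>
            exists_mulVec_eq_smul hd hcd hcd' hG hV hiso hnd (hVl S ∅) (h.trans hrM)
        · obtain ⟨F, a, g, h1, h2, h3, h4, h5, h6, h7, h8, h9, h10, h11⟩ := exists_generator hd hcd
            hcd' hG hV hiso hr hΔ hdiam hcoeff hψ hnd (hVl S s) hs h0 (hSr.trans hrM) hSr
          exact ⟨F, a, g, h1, h2, h3, h4, h5, h6, h7, h8, h9, h10, fun _ => ⟨0, by simp [h11]⟩⟩
    · exact trivial_solution fun h => (hSr h).elim
  choose F a g h1 h2 h3 h4 h5 h6 h7 h8 h9 h10 h11 using key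
  refine ⟨F, fun S s => a (S, s), fun S s => g (S, s), h1, h2, fun S s => h3 (S, s),
    fun S s => h4 (S, s), fun S s => h5 (S, s), h6, fun S s => h7 (S, s), fun S s => h8 (S, s),
    fun S s => h9 (S, s), ?_, fun S s => h11 (S, s)⟩
  rw [total_eq_sum_prod, total_eq_sum_prod, Finset.mul_sum, Finset.sum_mul,
    ← Finset.sum_sub_distrib]
  exact Finset.sum_congr rfl fun p _ => h10 p

end LocalSolution

/-! ### Concatenating time-ordered exponentials -/

section Glue

variable {E : Type*} [NormedAddCommGroup E] [NormedSpace ℝ E] {θ : ℝ}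

/-- The function on `[0, 1]` that runs through the constant `c` during `[0, θ]` and through `f`
during `[θ, 1]`, with the same integrals as at unit speed. -/
def glue (θ : ℝ) (c : E) (f : ℝ → E) (r : ℝ) : E :=
  if r ≤ θ then θ⁻¹ • c else (1 - θ)⁻¹ • f (r / (1 - θ) - θ / (1 - θ))

theorem intervalIntegrable_glue (hθ : 0 < θ) (hθ' : θ < 1) (c : E) {f : ℝ → E}
    (hf : IntervalIntegrable f MeasureTheory.volume 0 1) :
    IntervalIntegrable (glue θ c f) MeasureTheory.volume 0 1 := by
  have h1 : (0 : ℝ) < 1 - θ := by linarith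
  refine IntervalIntegrable.trans (b := θ) ?_ ?_
  · refine IntervalIntegrable.congr (f := fun _ => θ⁻¹ • c) (fun r hr => ?_)
      (_root_.intervalIntegrable_const)
    rw [Set.uIoc_of_le hθ.le] at hr
    simp [glue, hr.2]
  · have h2 := ((hf.comp_sub_right (θ / (1 - θ))).comp_mul_left (c := (1 - θ)⁻¹)).smul (1 - θ)⁻¹
    have e1 : (0 + θ / (1 - θ)) / (1 - θ)⁻¹ = θ := by field_simp; ring
    have e2 : (1 + θ / (1 - θ)) / (1 - θ)⁻¹ = 1 := by field_simp; ring
    rw [e1, e2] at h2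
    refine IntervalIntegrable.congr (fun r hr => ?_) h2
    rw [Set.uIoc_of_le hθ'.le] at hr
    simp only [glue, not_le.2 hr.1, if_false, Pi.smul_apply]
    rw [div_eq_inv_mul r]

end Glue

section TimeOrdered

variable {E : Type*} [NormedRing E] [NormedAlgebra ℝ E] [CompleteSpace E] {θ : ℝ}

/-- Running a constant generator `c` before a generator `A` multiplies the time-ordered exponential
by `exp c` from the right. -/
theorem exists_timeOrdered_glue (hθ : 0 < θ) (hθ' : θ < 1) (c : E) {A W : ℝ → E}
    (hA : IntervalIntegrable A MeasureTheory.volume 0 1)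
    (hW : ContinuousOn W (Set.Icc 0 1))
    (hAW : ∀ t ∈ Set.Icc (0 : ℝ) 1, W t = 1 + ∫ r in (0 : ℝ)..t, A r * W r) :
    ∃ W' : ℝ → E, ContinuousOn W' (Set.Icc 0 1) ∧
      (∀ t ∈ Set.Icc (0 : ℝ) 1, W' t = 1 + ∫ r in (0 : ℝ)..t, glue θ c A r * W' r) ∧
      W' 1 = W 1 * NormedSpace.exp c := by
  have h1 : (0 : ℝ) < 1 - θ := by linarith
  have hW0 : W 0 = 1 := by simpa using hAW 0 (by simp)
  set X : E := θ⁻¹ • c with hX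
  have hθX : θ • X = c := by rw [hX, smul_smul, mul_inv_cancel₀ hθ.ne', one_smul]
  let τ : ℝ → ℝ := fun t => t / (1 - θ) - θ / (1 - θ)
  have hτ : ∀ t, τ t = (t - θ) / (1 - θ) := fun t => by simp only [τ]; ring
  have hτθ : τ θ = 0 := by rw [hτ, sub_self, zero_div]
  have hτ1 : τ 1 = 1 := by rw [hτ, div_self h1.ne']
  have hτle : ∀ t, t ≤ 1 → τ t ≤ 1 := fun t ht => by
    rw [hτ, div_le_one h1]; linarith
  have hτ0 : ∀ t, t ≤ θ → τ t ≤ 0 := fun t ht => by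
    rw [hτ]; exact div_nonpos_of_nonpos_of_nonneg (by linarith) h1.le
  have hτpos : ∀ t, θ ≤ t → 0 ≤ τ t := fun t ht => by
    rw [hτ]; exact div_nonneg (by linarith) h1.le
  let W' : ℝ → E := fun t => W (max 0 (τ t)) * NormedSpace.exp (min t θ • X)
  have hW'1 : ∀ t, t ≤ θ → W' t = NormedSpace.exp (t • X) := fun t ht => by
    simp only [W']
    rw [max_eq_left (hτ0 t ht), min_eq_left ht, hW0, one_mul]
  have hW'2 : ∀ t, θ ≤ t → W' t = W (τ t) * NormedSpace.exp c := fun t ht => by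
    simp only [W']
    rw [max_eq_right (hτpos t ht), min_eq_right ht, hθX]
  have hexp : Continuous fun t : ℝ => NormedSpace.exp (t • X) :=
    continuous_iff_continuousAt.2 fun t => (hasDerivAt_exp_smul_const' X t).continuousAt
  have hW'c : ContinuousOn W' (Set.Icc 0 1) := by
    refine ContinuousOn.mul (hW.comp (Continuous.continuousOn ?_) fun t ht => ?_)
      (hexp.comp (continuous_id.min continuous_const)).continuousOn
    · exact continuous_const.max ((continuous_id.div_const _).sub continuous_const)
    · exact ⟨le_max_left _ _, max_le zero_le_one (hτle t ht.2)⟩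
  have hint : IntervalIntegrable (fun r => glue θ c A r * W' r) MeasureTheory.volume 0 1 :=
    (intervalIntegrable_glue hθ hθ' c hA).mul_continuousOn (by rwa [Set.uIcc_of_le zero_le_one])
  have hfirst : ∀ t, 0 ≤ t → t ≤ θ →
      ∫ r in (0 : ℝ)..t, glue θ c A r * W' r = NormedSpace.exp (t • X) - 1 := by
    intro t ht0 ht
    have h2 : ∫ r in (0 : ℝ)..t, glue θ c A r * W' r =
        ∫ r in (0 : ℝ)..t, X * NormedSpace.exp (r • X) := by
      refine intervalIntegral.integral_congr fun r hr => ?_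
      rw [Set.uIcc_of_le ht0] at hr
      simp only [glue, if_pos (hr.2.trans ht), hW'1 r (hr.2.trans ht), hX]
    rw [h2, intervalIntegral.integral_eq_sub_of_hasDerivAt
      (fun r _ => hasDerivAt_exp_smul_const' X r) ((continuous_const.mul hexp).intervalIntegrable _ _)]
    simp
  refine ⟨W', hW'c, fun t ht => ?_, ?_⟩
  · rcases le_total t θ with htθ | htθ
    · rw [hfirst t ht.1 htθ, hW'1 t htθ]; abel
    · have hi1 : IntervalIntegrable (fun r => glue θ c A r * W' r) MeasureTheory.volume 0 θ :=
        hint.mono_set (by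
          rw [Set.uIcc_of_le hθ.le, Set.uIcc_of_le zero_le_one]
          exact Set.Icc_subset_Icc_right hθ'.le)
      have hi2 : IntervalIntegrable (fun r => glue θ c A r * W' r) MeasureTheory.volume θ t :=
        hint.mono_set (by
          rw [Set.uIcc_of_le htθ, Set.uIcc_of_le zero_le_one]
          exact Set.Icc_subset_Icc hθ.le ht.2)
      have hAWi : IntervalIntegrable (fun r => A r * W r) MeasureTheory.volume 0 (τ t) :=
        (hA.mul_continuousOn (by rwa [Set.uIcc_of_le zero_le_one])).mono_set (by
          rw [Set.uIcc_of_le (hτpos t htθ), Set.uIcc_of_le zero_le_one]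
          exact Set.Icc_subset_Icc_right (hτle t ht.2))
      have h2 : ∫ r in θ..t, glue θ c A r * W' r =
          ∫ r in θ..t, (1 - θ)⁻¹ •
            (fun u => A u * W u * NormedSpace.exp c) (r / (1 - θ) - θ / (1 - θ)) := by
        refine intervalIntegral.integral_congr_ae (Filter.Eventually.of_forall fun r hr => ?_)
        rw [Set.uIoc_of_le htθ] at hr
        simp only [glue, not_le.2 hr.1, if_false, hW'2 r hr.1.le, τ]
        rw [smul_mul_assoc, mul_assoc]
      have h3 : ∫ u in (0 : ℝ)..τ t, A u * W u * NormedSpace.exp c =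
          (∫ u in (0 : ℝ)..τ t, A u * W u) * NormedSpace.exp c :=
        ((ContinuousLinearMap.mul ℝ E).flip (NormedSpace.exp c)).intervalIntegral_comp_comm hAWi
      rw [← intervalIntegral.integral_add_adjacent_intervals hi1 hi2, hfirst θ hθ.le le_rfl, h2,
        intervalIntegral.integral_smul, intervalIntegral.integral_comp_div_sub
          (fun u => A u * W u * NormedSpace.exp c) h1.ne', inv_smul_smul₀ h1.ne']
      change _ = 1 + (_ + ∫ u in (τ θ)..(τ t), A u * W u * NormedSpace.exp c)
      rw [hτθ, h3, hW'2 t htθ, hAW (τ t) ⟨hτpos t htθ, hτle t ht.2⟩, hθX, add_mul, one_mul]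
      abel
  · rw [hW'2 1 hθ'.le, hτ1]

end TimeOrdered

section GeneratedBy

variable {Λ : Type*} [Fintype Λ] [DecidableEq Λ] {G : SimpleGraph Λ} {q : Λ → ℕ}
  {ι : Type*} [Fintype ι] [DecidableEq ι]

/-- `U` is the time-ordered exponential of a path of anti-Hermitian local operators with norms at
most `a`. -/
def IsGenerated (C : CommutingProjectors G q ι) (K a : ℝ) (U : Op q) : Prop :=
  ∃ (A : ℝ → Finset Λ → Finset ι → Op q) (W : ℝ → Op q),
    (∀ S s, IntervalIntegrable (fun r => A r S s) MeasureTheory.volume 0 1) ∧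
    (∀ r ∈ Set.Icc (0 : ℝ) 1, C.IsLocalDecomposition (A r) ∧
      (total (A r)).conjTranspose = -total (A r) ∧ NormBound K (A r) a) ∧
    IsTimeOrderedExp (fun r => total (A r)) W ∧ W 1 = U

variable {C : CommutingProjectors G q ι} {K a b : ℝ} {U : Op q}

theorem isGenerated_one (ha : 0 ≤ a) : IsGenerated C K a 1 := by
  refine ⟨fun _ => 0, fun _ => 1, fun S s => ?_, fun r _ => ⟨isLocalDecomposition_zero, ?_,
    (NormBound.zero K).mono le_rfl ha⟩, ⟨continuousOn_const, fun t _ => ?_⟩, rfl⟩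
  · simp only [Pi.zero_apply]
    exact _root_.intervalIntegrable_const
  · rw [total_zero]; simp
  · simp [total_zero]

/-- The first factor in time is the last one in the product; its share of the time interval is
chosen in proportion to its norm, so that the norms add up. -/
theorem IsGenerated.mul_exp (h : IsGenerated C K a U) (ha : 0 < a) (hb : 0 < b)
    {B : Finset Λ → Finset ι → Op q} (hB : C.IsLocalDecomposition B)
    (hBa : (total B).conjTranspose = -total B) (hBn : NormBound K B b) :
    IsGenerated C K (a + b) (U * NormedSpace.exp (total B)) := by
  obtain ⟨A, W, hA1, hA2, ⟨hW, hAW⟩, rfl⟩ := h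
  have hab : 0 < a + b := by positivity
  set θ : ℝ := b / (a + b) with hθdef
  have hθ : 0 < θ := by positivity
  have hθ1 : 1 - θ = a / (a + b) := by rw [hθdef]; field_simp; ring
  have hθ' : θ < 1 := by
    have : 0 < 1 - θ := by rw [hθ1]; positivity
    linarith
  have htot : IntervalIntegrable (fun r => total (A r)) MeasureTheory.volume 0 1 := by
    have := IntervalIntegrable.sum (μ := MeasureTheory.volume) (a := 0) (b := 1)
      (Finset.univ : Finset (Finset Λ × Finset ι)) (f := fun p r => A r p.1 p.2)
      fun p _ => hA1 p.1 p.2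
    refine this.congr fun r _ => ?_
    rw [total_eq_sum_prod, Finset.sum_apply]
  have hsmul : ∀ (c : ℝ) (T : Finset Λ → Finset ι → Op q),
      total (fun S s => c • T S s) = c • total T := fun c T => by
    simp [total, Finset.smul_sum]
  have hglue : ∀ r, total (fun S s => glue θ (B S s) (fun r => A r S s) r) =
      glue θ (total B) (fun r => total (A r)) r := by
    intro r
    unfold glue
    split_ifs
    · exact hsmul _ _
    · exact hsmul _ (A _)
  have hcase : ∀ r ∈ Set.Icc (0 : ℝ) 1, ∃ (T : Finset Λ → Finset ι → Op q) (c t : ℝ),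
      (fun S s => glue θ (B S s) (fun r => A r S s) r) = (fun S s => c • T S s) ∧
      C.IsLocalDecomposition T ∧ (total T).conjTranspose = -total T ∧ NormBound K T t ∧ 0 ≤ c ∧
      c * t = a + b := by
    intro r hr
    by_cases hrθ : r ≤ θ
    · refine ⟨B, θ⁻¹, b, by simp [glue, hrθ], hB, hBa, hBn, by positivity, ?_⟩
      rw [hθdef]; field_simp
    · have hrθ' := not_le.1 hrθ
      have h1 : 0 < 1 - θ := by linarith
      obtain ⟨h2, h3, h4⟩ := hA2 (r / (1 - θ) - θ / (1 - θ)) (by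
        rw [← sub_div]
        exact ⟨div_nonneg (by linarith) h1.le, (div_le_one h1).2 (by linarith [hr.2])⟩)
      refine ⟨_, (1 - θ)⁻¹, a, by simp only [glue, hrθ, if_false], h2, h3, h4, by positivity, ?_⟩
      rw [hθ1]; field_simp
  obtain ⟨W', hW'1, hW'2, hW'3⟩ := exists_timeOrdered_glue hθ hθ' (total B) htot hW hAW
  refine ⟨fun r S s => glue θ (B S s) (fun r => A r S s) r, W', fun S s =>
    intervalIntegrable_glue hθ hθ' _ (hA1 S s), fun r hr => ?_, ⟨hW'1, fun t ht => ?_⟩, hW'3⟩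
  · obtain ⟨T, c, t, hT, h1, h2, h3, h4, h5⟩ := hcase r hr
    dsimp only
    rw [hT]
    refine ⟨fun S s => ?_, ?_, ?_⟩
    · have h6 : (c : ℂ) • T S s ∈ termSpace C S s := (termSpace C S s).smul_mem _ (h1 S s)
      rwa [Complex.coe_smul] at h6
    · rw [hsmul, Matrix.conjTranspose_smul, h2, star_trivial, smul_neg]
    · rw [← h5]
      exact h3.of_norm_le_mul h4 fun S s => by rw [norm_smul, Real.norm_of_nonneg h4]
  · simp_rw [hglue]
    exact hW'2 t ht

end GeneratedBy

/-! ### One step of the perturbative rotation -/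

section Step

variable {Λ : Type*} [Fintype Λ] [DecidableEq Λ] {G : SimpleGraph Λ} {q : Λ → ℕ}
  {ι : Type*} [Fintype ι] [DecidableEq ι] {C : CommutingProjectors G q ι}
  {d ℓD : ℕ} {cd K a b δ : ℝ} {D A : Finset Λ → Finset ι → Op q}

theorem card_le_of_finiteRange (hcd : 0 < cd) (hV : VolumeGrowth G d cd)
    (hD : C.IsLocalDecomposition D) (hDr : CommutingProjectors.FiniteRange G ℓD D) {S : Finset Λ}
    {s : Finset ι} (h : D S s ≠ 0) : (S.card : ℝ) ≤ cd * (max 1 (ℓD : ℝ)) ^ d :=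
  card_le_of_diam_le hV hcd ((hD S s).2.2 h).1 (hDr S s h)

/-- The commutator of a finite-range decomposition `D` with terms that act only on the subsets `F`
of their supports. No exponent is lost. -/
theorem normBound_bracket_finiteRange (hcd : 0 < cd) (hV : VolumeGrowth G d cd)
    (hD : C.IsLocalDecomposition D) (hDr : CommutingProjectors.FiniteRange G ℓD D)
    (hDn : NormBound 0 D δ) (hK : 0 ≤ K) (hK1 : K ≤ 1)
    (F : Finset Λ × Finset ι → Finset Λ) (hF : ∀ p, F p ⊆ p.1)
    (hAs : ∀ p, SupportedOn (F p) (A p.1 p.2)) (hA : NormBound K A a)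
    (hA' : ∀ i, siteSum (fun p => ((F p).card : ℝ) * (Real.exp (K * (p.1.card : ℝ)) * ‖A p.1 p.2‖))
      i ≤ b) :
    NormBound K (bracket D A)
      (2 * Real.exp (cd * (max 1 (ℓD : ℝ)) ^ d) * δ * (cd * (max 1 (ℓD : ℝ)) ^ d * a + b)) := by
  set B : ℝ := cd * (max 1 (ℓD : ℝ)) ^ d with hB
  have hB0 : 0 ≤ B := by positivity
  have hterm : ∀ p : Finset Λ × Finset ι, Real.exp (K * (p.1.card : ℝ)) * ‖D p.1 p.2‖ ≤
      Real.exp B * (Real.exp (0 * (p.1.card : ℝ)) * ‖D p.1 p.2‖) := by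
    intro p
    by_cases h0 : D p.1 p.2 = 0
    · simp [h0]
    · have hc := card_le_of_finiteRange hcd hV hD hDr h0
      rw [zero_mul, Real.exp_zero, one_mul]
      gcongr
      calc K * (p.1.card : ℝ) ≤ 1 * (p.1.card : ℝ) := by gcongr
        _ ≤ B := by rw [one_mul]; exact hc
  refine (normBound_bracket (b := Real.exp B * δ) (b' := B * (Real.exp B * δ)) hK F hF
    (fun S s => (hD S s).1) hAs (fun i => ?_) hA (fun i => ?_) hA').mono le_rfl
    (le_of_eq (by ring))
  · refine (siteSum_mono hterm i).trans ?_
    rw [siteSum_mul]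
    gcongr
    exact hDn i
  · refine (siteSum_mono (w' := fun p => B * (Real.exp B *
      (Real.exp (0 * (p.1.card : ℝ)) * ‖D p.1 p.2‖))) (fun p => ?_) i).trans ?_
    · by_cases h0 : D p.1 p.2 = 0
      · simp [h0]
      · have hc := card_le_of_finiteRange hcd hV hD hDr h0
        exact mul_le_mul hc (hterm p) (by positivity) hB0
    · rw [siteSum_mul, siteSum_mul]
      gcongr
      exact hDn i

/-- The state of the iteration: a unitary generated by local operators of norm at most `a` rotates
`Y` into `X`, plus local terms of norm at most `w` of which those on at most `M` sites have `ψ` as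
an eigenvector, plus a remainder of norm at most `v`. -/
def IsStage (C : CommutingProjectors G q ι) (X Y : Op q) (ψ : Config q → ℂ) (M K₀ K a v w : ℝ) :
    Prop :=
  ∃ (U : Op q) (T V : Finset Λ → Finset ι → Op q), IsGenerated C K₀ a U ∧
    Uᴴ * Y * U = X + total T + total V ∧ C.IsLocalDecomposition T ∧ C.IsLocalDecomposition V ∧
    (∀ S s, (T S s).IsHermitian) ∧ (∀ S s, (V S s).IsHermitian) ∧ NormBound K T w ∧
    NormBound K V v ∧ ∀ (S : Finset Λ) s, (S.card : ℝ) ≤ M → ∃ c : ℂ, (T S s).mulVec ψ = c • ψ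

theorem IsStage.mono {X Y : Op q} {ψ : Config q → ℂ} {M K₀ K' a' v w v' w' : ℝ}
    (h : IsStage C X Y ψ M K₀ K a v w) (hK : K' ≤ K) (ha : a ≤ a') (hv : v ≤ v') (hw : w ≤ w') :
    IsStage C X Y ψ M K₀ K' a' v' w' := by
  obtain ⟨U, T, V, ⟨A, W, h1, h2, h3⟩, h4, h5, h6, h7, h8, h9, h10, h11⟩ := h
  exact ⟨U, T, V, ⟨A, W, h1, fun r hr => ⟨(h2 r hr).1, (h2 r hr).2.1, (h2 r hr).2.2.mono le_rfl ha⟩,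
    h3⟩, h4, h5, h6, h7, h8, h9.mono hK hw, h10.mono hK hv, h11⟩

theorem total_isHermitian {T : Finset Λ → Finset ι → Op q} (h : ∀ S s, (T S s).IsHermitian) :
    (total T).IsHermitian := by
  unfold Matrix.IsHermitian
  rw [total_conjTranspose]
  congr 1
  funext S s
  exact h S s

/-- One rotation. It turns the remainder into terms that have `ψ` as an eigenvector. The new
remainder consists of commutators with the generator, which are small: that with `D` because the
generator acts on few sites compared to its energy denominator, the others because of the loss `h`
of the exponent. -/
theorem IsStage.step {cd' R' r Δ : ℝ} {ℓ₀ : ℕ} {ψ : Config q → ℂ} (hd : 1 ≤ d) (hcd : 0 < cd)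
    (hcd' : 0 < cd') (hG : G.Connected) (hV : VolumeGrowth G d cd)
    (hiso : Isoperimetric G d cd' (cd * R' ^ d)) (hr : 0 ≤ r)
    (hΔ : 0 < Δ) (hdiam : ∀ f, diam G (C.supp f) ≤ ℓ₀) (hcoeff : ∀ f, Δ ≤ C.coeff f)
    (hψ : C.IsGroundState ψ) (hnd : C.LocallyNondegenerate d cd R' ψ)
    (hrM : r ^ d ≤ cd * R' ^ d)
    (hD : C.IsLocalDecomposition D) (hDr : CommutingProjectors.FiniteRange G ℓD D)
    (hDn : NormBound 0 D δ) {Y : Op q} (hY : Y.IsHermitian)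
    (hDh : (total D).IsHermitian) {K₀ h v w : ℝ} (hK1 : K ≤ 1) (hK₀ : 0 ≤ K₀) (hh : 0 < h)
    (hK₀h : K₀ ≤ K - h) (ha : 0 < a) (hv : 0 < v) (hx : 12 * (v / Δ) / h < 1)
    (hsmall : 2 * Real.exp (cd * (max 1 (ℓD : ℝ)) ^ d) * δ * (cd * (max 1 (ℓD : ℝ)) ^ d +
      cd * (max 1 (ℓ₀ : ℝ)) ^ d * (1 + cd * 2 ^ d * r / cd')) ≤ Δ / 8)
    (hst : IsStage C (C.hamiltonian + total D) Y ψ (r ^ d) K₀ K a v w) :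
    IsStage C (C.hamiltonian + total D) Y ψ (r ^ d) K₀ (K - h) (a + v / Δ)
      (v / 8 + 12 * (v / Δ) / h / (1 - 12 * (v / Δ) / h) * (v + v / 8) +
        12 * (v / Δ) / h / (1 - 12 * (v / Δ) / h) * (w + v)) (w + v + v) := by
  obtain ⟨U, T, V, hU, hUY, hT, hVl, hTh, hVh, hTn, hVn, hTψ⟩ := hst
  have := hG.nonempty
  have hK : 0 ≤ K := by linarith
  obtain ⟨F, A, g, hF, hAF, hA, hAa, hAΔ, hAF', hg, hgh, hgn, hcomm, hgψ⟩ :=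
    exists_generator_family hd hcd hcd' hG hV hiso hr hΔ hdiam hcoeff hψ hnd hrM hVl
  set κ : ℝ := cd * (max 1 (ℓ₀ : ℝ)) ^ d * (1 + cd * 2 ^ d * r / cd') with hκ
  set B : ℝ := cd * (max 1 (ℓD : ℝ)) ^ d with hB
  set x : ℝ := 12 * (v / Δ) / h with hxdef
  have hκ0 : 0 ≤ κ := by positivity
  have hAn : NormBound K A (v / Δ) := by
    rw [div_eq_inv_mul]
    refine hVn.of_norm_le_mul (by positivity) fun S s => ?_
    rw [← div_eq_inv_mul, le_div_iff₀ hΔ]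
    exact hAΔ S s
  have hAn' : ∀ i, siteSum (fun p => ((F p).card : ℝ) *
      (Real.exp (K * (p.1.card : ℝ)) * ‖A p.1 p.2‖)) i ≤ κ / Δ * v := by
    intro i
    refine (siteSum_mono (w' := fun p => κ / Δ * (Real.exp (K * (p.1.card : ℝ)) * ‖V p.1 p.2‖))
      (fun p => ?_) i).trans ?_
    · have h1 : ((F p).card : ℝ) * ‖A p.1 p.2‖ ≤ κ / Δ * ‖V p.1 p.2‖ := by
        rw [div_mul_eq_mul_div, le_div_iff₀ hΔ]
        exact hAF' p
      calc ((F p).card : ℝ) * (Real.exp (K * (p.1.card : ℝ)) * ‖A p.1 p.2‖)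
          = Real.exp (K * (p.1.card : ℝ)) * (((F p).card : ℝ) * ‖A p.1 p.2‖) := by ring
        _ ≤ Real.exp (K * (p.1.card : ℝ)) * (κ / Δ * ‖V p.1 p.2‖) := by gcongr
        _ = _ := by ring
    · rw [siteSum_mul]
      exact mul_le_mul_of_nonneg_left (hVn i) (by positivity)
  have hbr : NormBound K (bracket D A) (v / 8) := by
    refine (normBound_bracket_finiteRange hcd hV hD hDr hDn hK hK1 F hF hAF hAn hAn').mono le_rfl ?_
    calc 2 * Real.exp B * δ * (B * (v / Δ) + κ / Δ * v)
        = (2 * Real.exp B * δ * (B + κ)) * (v / Δ) := by ring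
      _ ≤ Δ / 8 * (v / Δ) := by gcongr
      _ = v / 8 := by field_simp
  have hbrl : C.IsLocalDecomposition (bracket D A) := isLocalDecomposition_bracket hD hA
  have hgn' : NormBound K g v := hVn.of_norm_le hgn
  -- `B₁` is the commutator of the unperturbed part with the generator.
  set B₁ : Finset Λ → Finset ι → Op q := fun S s => g S s + bracket D A S s with hB₁
  set B₂ : Finset Λ → Finset ι → Op q := fun S s => T S s + V S s with hB₂
  have hB₁l : C.IsLocalDecomposition B₁ := isLocalDecomposition_add hg hbrl
  have hB₂l : C.IsLocalDecomposition B₂ := isLocalDecomposition_add hT hVl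
  have hB₁n : NormBound K B₁ (v + v / 8) := hgn'.add hbr
  have hB₂n : NormBound K B₂ (w + v) := hTn.add hVn
  have hhK : h ≤ K := by linarith
  have hXA : (C.hamiltonian + total D) * total A - total A * (C.hamiltonian + total D) =
      total B₁ := by
    rw [hB₁, total_add, total_bracket, ← hcomm, add_mul, mul_add]
    abel
  have e1 := exp_conj_of_commutator hA hB₁l hh hhK hAn hB₁n hx _ hXA
  have e2 := exp_conj_total hA hB₂l hh hhK hAn hB₂n hx
  have hl1 := isLocalDecomposition_adSeries (d := fun k => ((k + 2).factorial : ℝ)⁻¹) hA hB₁l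
  have hl2 := isLocalDecomposition_adSeries (d := fun k => ((k + 1).factorial : ℝ)⁻¹) hA hB₂l
  have hn1 := normBound_adSeries (d := fun k => ((k + 2).factorial : ℝ)⁻¹) hA hB₁l hh hhK hAn hB₁n
    (fun k => by
      have : (0 : ℝ) < ((k + 2).factorial : ℝ) := by positivity
      rw [abs_of_pos (by positivity), inv_mul_le_one₀ this]
      exact_mod_cast Nat.factorial_le (by omega)) hx
  have hn2 := normBound_adSeries (d := fun k => ((k + 1).factorial : ℝ)⁻¹) hA hB₂l hh hhK hAn hB₂n
    (fun k => by
      have : (0 : ℝ) < ((k + 1).factorial : ℝ) := by positivity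
      rw [abs_of_pos (by positivity), inv_mul_cancel₀ this.ne']) hx
  set V₁ := adSeries (fun k => ((k + 2).factorial : ℝ)⁻¹) A B₁
  set V₂ := adSeries (fun k => ((k + 1).factorial : ℝ)⁻¹) A B₂
  set V' : Finset Λ → Finset ι → Op q := fun S s =>
    (fun S s => bracket D A S s + V₁ S s) S s + V₂ S s with hV'
  set T' : Finset Λ → Finset ι → Op q := fun S s => (fun S s => T S s + V S s) S s + g S s with hT'
  have hAah : (total A)ᴴ = -total A := by
    rw [total_conjTranspose]
    simp_rw [hAa]
    simp [total]
  have hT'h : ∀ S s, (T' S s).IsHermitian := fun S s => ((hTh S s).add (hVh S s)).add (hgh S s)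
  have hV'l : C.IsLocalDecomposition V' :=
    isLocalDecomposition_add (isLocalDecomposition_add hbrl hl1) hl2
  have hconj : (U * NormedSpace.exp (total A))ᴴ * Y * (U * NormedSpace.exp (total A)) =
      C.hamiltonian + total D + total T' + total V' := by
    have e3 : (U * NormedSpace.exp (total A))ᴴ * Y * (U * NormedSpace.exp (total A)) =
        NormedSpace.exp (-total A) * (Uᴴ * Y * U) * NormedSpace.exp (total A) := by
      rw [Matrix.conjTranspose_mul, ← Matrix.exp_conjTranspose, hAah]
      simp only [mul_assoc]
    have e4 : C.hamiltonian + total D + total T + total V =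
        (C.hamiltonian + total D) + total B₂ := by
      rw [hB₂, total_add]; abel
    rw [e3, hUY, e4, mul_add, add_mul, e1, e2, hB₁, hB₂, hV', hT']
    simp only [total_add]
    abel
  have hV'h : (total V').IsHermitian := by
    have e5 : total V' = (U * NormedSpace.exp (total A))ᴴ * Y * (U * NormedSpace.exp (total A)) -
        (C.hamiltonian + total D) - total T' := by
      rw [hconj]; abel
    rw [e5]
    exact ((Matrix.isHermitian_conjTranspose_mul_mul _ hY).sub
      (CommutingProjectors.hamiltonian_isHermitian.add hDh)).sub (total_isHermitian hT'h)
  refine ⟨U * NormedSpace.exp (total A), T', symmetrize V', hU.mul_exp ha (by positivity) hA hAah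
    (hAn.mono (by linarith) le_rfl), ?_, isLocalDecomposition_add hB₂l hg,
    isLocalDecomposition_symmetrize hV'l, hT'h, symmetrize_isHermitian,
    (hB₂n.add hgn').mono (by linarith) le_rfl, ?_, fun S s hS => ?_⟩
  · rw [total_symmetrize hV'h, hconj]
  · exact (((hbr.mono (by linarith) le_rfl).add hn1).add hn2).symmetrize
  · obtain ⟨c, hc⟩ := hTψ S s hS
    obtain ⟨c', hc'⟩ := hgψ S s hS
    refine ⟨c + c', ?_⟩
    rw [add_smul, ← hc, ← hc', ← Matrix.add_mulVec]
    simp only [hT', add_assoc]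

end Step

/-! ### Reading off the diagonal form -/

section Readoff

variable {Λ : Type*} [Fintype Λ] [DecidableEq Λ] {G : SimpleGraph Λ} {q : Λ → ℕ}
  {ι : Type*} [Fintype ι] [DecidableEq ι] {C : CommutingProjectors G q ι}

theorem exists_real_of_isHermitian {n : Type*} [Fintype n] {H : Matrix n n ℂ}
    (hH : H.IsHermitian) {ψ : n → ℂ} (hψ : star ψ ⬝ᵥ ψ = 1) {c : ℂ} (h : H.mulVec ψ = c • ψ) :
    ∃ E : ℝ, H.mulVec ψ = (E : ℂ) • ψ := by
  have h1 : star ψ ⬝ᵥ H.mulVec ψ = c := by rw [h, dotProduct_smul, hψ, smul_eq_mul, mul_one]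
  have h2 : star ψ ⬝ᵥ H.mulVec ψ = star c := by
    rw [Matrix.dotProduct_mulVec]
    have : Matrix.vecMul (star ψ) H = star (H.mulVec ψ) := by
      rw [Matrix.star_mulVec, hH.eq]
    rw [this, h, star_smul, smul_dotProduct, hψ, smul_eq_mul, mul_one]
  refine ⟨c.re, ?_⟩
  rw [h, Complex.conj_eq_iff_re.1 (h2.symm.trans h1)]

theorem exists_total_mulVec_eq_smul {T : Finset Λ → Finset ι → Op q} {ψ : Config q → ℂ}
    (h : ∀ S s, ∃ c : ℂ, (T S s).mulVec ψ = c • ψ) : ∃ c : ℂ, (total T).mulVec ψ = c • ψ := by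
  choose c hc using h
  refine ⟨∑ S, ∑ s, c S s, ?_⟩
  unfold total
  simp_rw [Matrix.sum_mulVec, hc, Finset.sum_smul]

/-- A rotated Hamiltonian is diagonalized by `ψ` up to the remainder and the terms on large
sets. -/
theorem IsStage.locallyDiagonalizable [Nonempty Λ] {X V : Op q} {ψ : Config q → ℂ}
    {M K₀ K a v w v' δ' : ℝ} (hX : X.IsHermitian) (hψ : star ψ ⬝ᵥ ψ = 1)
    (hXψ : ∃ c : ℂ, X.mulVec ψ = c • ψ) (hK₀ : 0 ≤ K₀) (hK : K₀ ≤ K)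
    (hδ' : w + v ≤ δ') (hv' : v + Real.exp (-(K₀ * M)) * w ≤ v')
    (h : IsStage C X (X + V) ψ M K₀ K a v w) : LocallyDiagonalizable C X V ψ v' δ' a K₀ := by
  obtain ⟨U, T, V', ⟨A, W, h1, h2, h3, rfl⟩, hUY, hT, hV, hTh, hVh, hTn, hVn, hTψ⟩ := h
  set Ts : Finset Λ → Finset ι → Op q := fun S s => if (S.card : ℝ) ≤ M then T S s else 0 with hTs
  set Tl : Finset Λ → Finset ι → Op q := fun S s => if (S.card : ℝ) ≤ M then 0 else T S s with hTl
  have hsplit : total T = total Ts + total Tl := by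
    rw [← total_add]
    congr 1
    funext S s
    simp only [hTs, hTl]
    split_ifs <;> simp
  have hTsh : (total Ts).IsHermitian := total_isHermitian fun S s => by
    simp only [hTs]
    split_ifs
    · exact hTh S s
    · exact Matrix.isHermitian_zero
  have hTlh : (total Tl).IsHermitian := total_isHermitian fun S s => by
    simp only [hTl]
    split_ifs
    · exact Matrix.isHermitian_zero
    · exact hTh S s
  have hTll : C.IsLocalDecomposition Tl := fun S s => by
    change Tl S s ∈ termSpace C S s
    simp only [hTl]
    split_ifs
    · exact Submodule.zero_mem _
    · exact hT S s
  have hTlK : NormBound 0 Tl (Real.exp (-(K₀ * M)) * w) := by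
    refine (hTn.mono hK le_rfl).of_large hK₀ M (fun S s hne => ?_) fun S s => ?_
    · by_contra hlt
      exact hne (by simp only [hTl, (not_le.1 hlt).le, if_true])
    · simp only [hTl]
      split_ifs <;> simp
  obtain ⟨c₁, hc₁⟩ := hXψ
  obtain ⟨c₂, hc₂⟩ := exists_total_mulVec_eq_smul (T := Ts) (ψ := ψ) fun S s => by
    simp only [hTs]
    split_ifs with hS
    · exact hTψ S s hS
    · exact ⟨0, by simp⟩
  refine ⟨A, W, h1, fun r hr => ⟨(h2 r hr).1, (h2 r hr).2.1, (h2 r hr).2.2.localNorm_le⟩, h3,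
    X + total Ts, total fun S s => V' S s + Tl S s, hX.add hTsh, ?_, ?_, ?_,
    ⟨fun S s => T S s + V' S s, isLocalDecomposition_add hT hV, ?_, ?_⟩,
    ⟨_, isLocalDecomposition_add hV hTll, rfl, ?_⟩⟩
  · rw [total_add]
    exact (total_isHermitian hVh).add hTlh
  · rw [hUY, hsplit, total_add]; abel
  · refine exists_real_of_isHermitian (hX.add hTsh) hψ (c := c₁ + c₂) ?_
    rw [Matrix.add_mulVec, hc₁, hc₂, add_smul]
  · rw [total_add, total_add, hsplit]; abel
  · exact ((hTn.add hVn).mono hK hδ').localNorm_le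
  · exact (((hVn.mono (hK₀.trans hK) le_rfl).add hTlK).mono le_rfl hv').localNorm_le

/-- The recursion for the norms in one step, with quartered remainders. -/
theorem remainder_le {v w x ε p : ℝ} (hp : 0 ≤ p) (hp1 : p ≤ 1) (hε : 0 ≤ ε) (hv : v = ε * p)
    (hw : w = 8 / 3 * ε * (1 - p)) (hx : x ≤ p / 100) :
    v / 8 + x / (1 - x) * (v + v / 8) + x / (1 - x) * (w + v) ≤ ε * (p / 4) := by
  have hx1 : x ≤ 1 / 100 := by linarith
  have hy : x / (1 - x) ≤ p / 99 := by
    rw [div_le_iff₀ (by linarith)]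
    nlinarith
  have hv0 : 0 ≤ v := by rw [hv]; positivity
  have hwv : w + v ≤ 3 * ε := by
    rw [hw, hv]; nlinarith [mul_nonneg hε hp]
  have hwv0 : 0 ≤ w + v := by
    have : 0 ≤ 1 - p := by linarith
    have : 0 ≤ w := by rw [hw]; positivity
    linarith
  have e1 : x / (1 - x) * (v + v / 8) ≤ p / 99 * (v + v / 8) := by gcongr
  have e2 : x / (1 - x) * (w + v) ≤ p / 99 * (3 * ε) := by gcongr
  have e3 : p / 99 * (v + v / 8) ≤ 1 / 99 * (v + v / 8) := by gcongr
  have e4 : p / 99 * (3 * ε) = v / 33 := by rw [hv]; ring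
  have e5 : ε * (p / 4) = v / 4 := by rw [hv]; ring
  linarith

end Readoff

/-! ### The diagonalizing rotation -/

section Diagonalization

variable {Λ : Type*} [Fintype Λ] [DecidableEq Λ] {G : SimpleGraph Λ} {q : Λ → ℕ}
  {ι : Type*} [Fintype ι] [DecidableEq ι] {C : CommutingProjectors G q ι}
  {d ℓ₀ ℓD : ℕ} {cd cd' R' r Δ δ ε K₁ : ℝ} {D V : Finset Λ → Finset ι → Op q} {ψ : Config q → ℂ}

/-- `N` rotations, each of which loses the same share of the exponent and reduces the remainder to
a quarter. -/
theorem exists_stage (hd : 1 ≤ d) (hcd : 0 < cd)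
    (hcd' : 0 < cd') (hG : G.Connected) (hV : VolumeGrowth G d cd)
    (hiso : Isoperimetric G d cd' (cd * R' ^ d)) (hr : 0 ≤ r)
    (hΔ : 0 < Δ) (hdiam : ∀ f, diam G (C.supp f) ≤ ℓ₀) (hcoeff : ∀ f, Δ ≤ C.coeff f)
    (hψ : C.IsGroundState ψ) (hnd : C.LocallyNondegenerate d cd R' ψ)
    (hrM : r ^ d ≤ cd * R' ^ d)
    (hD : C.IsLocalDecomposition D) (hDr : CommutingProjectors.FiniteRange G ℓD D)
    (hDn : NormBound 0 D δ) (hDh : (total D).IsHermitian)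
    (hVl : C.IsLocalDecomposition V) (hVh : (total V).IsHermitian) (hVn : NormBound K₁ V ε)
    (hK₁ : 0 < K₁) (hK₁' : K₁ ≤ 1) (hε : 0 ≤ ε)
    (hsmall : 2 * Real.exp (cd * (max 1 (ℓD : ℝ)) ^ d) * δ * (cd * (max 1 (ℓD : ℝ)) ^ d +
      cd * (max 1 (ℓ₀ : ℝ)) ^ d * (1 + cd * 2 ^ d * r / cd')) ≤ Δ / 8)
    (N : ℕ) (hN : 0 < N → 0 < ε) (hNε : 1440 * (ε * N) ≤ K₁ * Δ) :
    ∃ K, K₁ / 6 ≤ K ∧ IsStage C (C.hamiltonian + total D) (C.hamiltonian + total D + total V) ψ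
      (r ^ d) (K₁ / 6) K (2 * ε / Δ) (ε * (1 / 4) ^ N) (8 / 3 * ε * (1 - (1 / 4) ^ N)) := by
  rcases N.eq_zero_or_pos with rfl | hN0
  · refine ⟨K₁, by linarith, 1, 0, symmetrize V, isGenerated_one (by positivity), ?_,
      isLocalDecomposition_zero, isLocalDecomposition_symmetrize hVl, fun _ _ =>
      Matrix.isHermitian_zero, symmetrize_isHermitian, (NormBound.zero _).mono le_rfl (by simp),
      hVn.symmetrize.mono le_rfl (by simp), fun _ _ _ => ⟨0, by simp⟩⟩
    rw [total_symmetrize hVh, total_zero]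
    simp
  have hε0 := hN hN0
  have hN' : (0 : ℝ) < N := by exact_mod_cast hN0
  set h : ℝ := 5 * K₁ / (6 * N) with hh
  have hh0 : 0 < h := by positivity
  have hhN : N * h = 5 / 6 * K₁ := by rw [hh]; field_simp
  have key : ∀ n ≤ N, IsStage C (C.hamiltonian + total D) (C.hamiltonian + total D + total V) ψ
      (r ^ d) (K₁ / 6) (K₁ - n * h) ((2 - 4 / 3 * (1 / 4) ^ n) * (ε / Δ)) (ε * (1 / 4) ^ n)
      (8 / 3 * ε * (1 - (1 / 4) ^ n)) := by
    intro n
    induction n with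
    | zero =>
      intro _
      refine ⟨1, 0, symmetrize V, isGenerated_one ?_, ?_,
        isLocalDecomposition_zero, isLocalDecomposition_symmetrize hVl, fun _ _ =>
        Matrix.isHermitian_zero, symmetrize_isHermitian, (NormBound.zero _).mono le_rfl (by simp),
        hVn.symmetrize.mono (by simp) (by simp), fun _ _ _ => ⟨0, by simp⟩⟩
      · norm_num
        positivity
      · rw [total_symmetrize hVh, total_zero]
        simp
    | succ n ih =>
      intro hn
      have hp0 : (0 : ℝ) < (1 / 4) ^ n := by positivity
      have hp1 : ((1 : ℝ) / 4) ^ n ≤ 1 := pow_le_one₀ (by norm_num) (by norm_num)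
      have hnh : ((n : ℝ) + 1) * h ≤ 5 / 6 * K₁ := by
        rw [← hhN]
        have : ((n : ℝ) + 1) ≤ N := by exact_mod_cast hn
        gcongr
      have hnh0 : 0 ≤ (n : ℝ) * h := by positivity
      have hx : 12 * (ε * (1 / 4) ^ n / Δ) / h ≤ (1 / 4) ^ n / 100 := by
        rw [div_le_iff₀ hh0, mul_div_assoc', div_le_iff₀ hΔ]
        have e : (1 / 4 : ℝ) ^ n / 100 * h * Δ = (1 / 4) ^ n * (K₁ * Δ) / (120 * N) := by
          rw [hh]; field_simp; norm_num
        rw [e, le_div_iff₀ (by positivity)]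
        nlinarith [mul_le_mul_of_nonneg_left hNε hp0.le]
      refine (IsStage.step (h := h) hd hcd hcd' hG hV hiso hr hΔ hdiam hcoeff hψ hnd hrM hD hDr hDn
        ((CommutingProjectors.hamiltonian_isHermitian.add hDh).add hVh) hDh (by linarith)
        (by positivity) hh0 (by linarith) ?_ (by positivity) ?_ hsmall (ih (by omega))).mono
        (le_of_eq ?_) (le_of_eq ?_) ?_ (le_of_eq ?_)
      · have : 0 < 2 - 4 / 3 * (1 / 4 : ℝ) ^ n := by linarith
        positivity
      · linarith
      · push_cast; ring
      · rw [pow_succ]; ring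
      · rw [pow_succ, ← div_eq_mul_one_div]
        exact remainder_le hp0.le hp1 hε rfl rfl hx
      · rw [pow_succ]; ring
  refine ⟨K₁ - N * h, by rw [hhN]; linarith, (key N le_rfl).mono le_rfl ?_ le_rfl le_rfl⟩
  have : (0 : ℝ) ≤ (1 / 4) ^ N := by positivity
  have e : 2 * ε / Δ = 2 * (ε / Δ) := by ring
  rw [e]
  gcongr
  linarith

/-- The block-diagonal part has `ψ` as an eigenvector. -/
theorem exists_total_mulVec_eq_smul_of_blockDiagonal (hd : 1 ≤ d) (hcd : 0 < cd) (hcd' : 0 < cd')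
    (hG : G.Connected) (hV : VolumeGrowth G d cd) (hiso : Isoperimetric G d cd' (cd * R' ^ d))
    (hψ : C.IsGroundState ψ) (hnd : C.LocallyNondegenerate d cd R' ψ)
    (hD : C.IsLocalDecomposition D) (hDr : CommutingProjectors.FiniteRange G ℓD D)
    (hDb : C.LocallyBlockDiagonal D) (hR' : max 1 (ℓD : ℝ) ≤ R') :
    ∃ c : ℂ, (total D).mulVec ψ = c • ψ := by
  refine exists_total_mulVec_eq_smul fun S s => ?_
  by_cases h0 : D S s = 0
  · exact ⟨0, by simp [h0]⟩
  rcases s.eq_empty_or_nonempty with rfl | hs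
  · refine exists_mulVec_eq_smul hd hcd hcd' hG hV hiso hnd (hD S ∅)
      ((card_le_of_finiteRange hcd hV hD hDr h0).trans ?_)
    gcongr
  · exact ⟨0, by rw [mulVec_eq_zero_of_blockDiagonal hψ (hD S s) hs (hDb S s), zero_smul]⟩

end Diagonalization

/-! ### The constants -/

/-- Bounds on the order of the expansion. Its logarithmic factor is at least one and can be
dropped. In the case `ε = 0`, the order is zero because of the convention for division by zero. -/
theorem optimalOrder_le {c Δ ε R : ℝ} {d : ℕ} (hc : 0 ≤ c) (hε : 0 ≤ ε) (hR : 0 ≤ R)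
    (h : 3 * ε ≤ Δ) : (optimalOrder c Δ ε R d : ℝ) ≤ c * R ^ d ∧
      ε * (optimalOrder c Δ ε R d : ℝ) ≤ c * Δ ∧ (0 < optimalOrder c Δ ε R d → 0 < ε) := by
  unfold optimalOrder
  have hΔ : 0 ≤ Δ := by linarith
  have hfl : (⌊c * min ((Δ / ε) / Real.log (Δ / ε) ^ 2) (R ^ d)⌋₊ : ℝ) ≤
      c * min ((Δ / ε) / Real.log (Δ / ε) ^ 2) (R ^ d) :=
    Nat.floor_le (mul_nonneg hc (le_min (by positivity) (by positivity)))
  refine ⟨hfl.trans (mul_le_mul_of_nonneg_left (min_le_right _ _) hc), ?_, fun hpos => ?_⟩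
  · rcases hε.eq_or_lt with rfl | hε0
    · rw [zero_mul]; positivity
    · have h3 : 3 ≤ Δ / ε := by rwa [le_div_iff₀ hε0]
      have hlog : 1 ≤ Real.log (Δ / ε) := by
        rw [Real.le_log_iff_exp_le (by linarith)]
        linarith [Real.exp_one_lt_three]
      have h1 : (Δ / ε) / Real.log (Δ / ε) ^ 2 ≤ Δ / ε :=
        div_le_self (by positivity) (one_le_pow₀ hlog)
      have h2 := hfl.trans (mul_le_mul_of_nonneg_left ((min_le_left _ _).trans h1) hc)
      calc ε * _ ≤ ε * (c * (Δ / ε)) := mul_le_mul_of_nonneg_left h2 hε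
        _ = c * Δ := by field_simp
  · rcases hε.eq_or_lt with rfl | hε0
    · have : min ((Δ / 0) / Real.log (Δ / 0) ^ 2) (R ^ d) = 0 := by
        simp only [div_zero, zero_div]
        exact min_eq_left (by positivity)
      rw [this, mul_zero, Nat.floor_zero] at hpos
      exact (lt_irrefl 0 hpos).elim
    · exact hε0

/-- The choice of the constants. The radius `m R` of the sets on which the terms are treated, and
the ratio `δ / Δ`, are small enough that the block-diagonal part does not close the gap. -/
theorem gap_condition {B v g cd' m δ Δ : ℝ} (hB : 0 ≤ B) (hv : 0 < v) (hg : 0 < g) (hcd' : 0 < cd')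
    (hδ : 0 < δ) (hΔ : 0 < Δ) (hm : m ≤ cd' / (32 * Real.exp B * v * g))
    (h : δ ≤ 1 / (32 * Real.exp B * (B + v)) * Δ) :
    2 * Real.exp B * δ * (B + v * (1 + g * (m * (1 * Δ / δ)) / cd')) ≤ Δ / 8 := by
  have hE := Real.exp_pos B
  rw [le_div_iff₀ (by positivity)] at hm
  rw [div_mul_eq_mul_div, one_mul, le_div_iff₀ (by positivity)] at h
  have e : 2 * Real.exp B * δ * (B + v * (1 + g * (m * (1 * Δ / δ)) / cd')) =
      δ * (32 * Real.exp B * (B + v)) / 16 + m * (32 * Real.exp B * v * g) / cd' * Δ / 16 := by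
    field_simp
    ring
  have h2 : m * (32 * Real.exp B * v * g) / cd' ≤ 1 := by rwa [div_le_one hcd']
  rw [e]
  nlinarith

end FalseVacuum

end

open FalseVacuum in
theorem mainTheorem5 (d : ℕ) (hd : 1 ≤ d) (cd cd' : ℝ) (hcd : 0 < cd) (hcd' : 0 < cd')
    (ℓ₀ ℓD : ℕ) (K₁ : ℝ) (hK₁ : 0 < K₁) (hK₁' : K₁ ≤ 1) :
    ∃ cR cV cS : ℝ, 0 < cR ∧ 0 < cV ∧ 0 < cS ∧
      ∀ (Λ : Type*) [Fintype Λ] [DecidableEq Λ] (G : SimpleGraph Λ) (q : Λ → ℕ)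
        (ι : Type*) [Fintype ι] [DecidableEq ι] (C : CommutingProjectors G q ι)
        (Δ R' δ ε : ℝ) (ψ : Config q → ℂ) (D V : Finset Λ → Finset ι → Op q),
        -- the graph
        G.Connected → VolumeGrowth G d cd → Isoperimetric G d cd' (cd * R' ^ d) →
        -- the commuting frustration-free Hamiltonian and its ground state
        0 < Δ → (∀ f, diam G (C.supp f) ≤ ℓ₀) → (∀ f, Δ ≤ C.coeff f) →
        C.FrustrationFree → C.IsGroundState ψ → C.LocallyNondegenerate d cd R' ψ →
        -- the locally block-diagonal part
        C.IsLocalDecomposition D → (total D).IsHermitian → CommutingProjectors.FiniteRange G ℓD D →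
        C.LocallyBlockDiagonal D → 0 < δ → localNorm 0 D ≤ δ → δ ≤ cV * Δ →
        -- the perturbation
        C.IsLocalDecomposition V → (total V).IsHermitian → localNorm K₁ V ≤ ε → ε ≤ cV * Δ →
        cR * Δ / δ < R' →
        LocallyDiagonalizable C (C.hamiltonian + total D) (total V) ψ
          (ε * 2 ^ (2 - (optimalOrder cS Δ ε (cR * Δ / δ) d : ℝ))) (4 * ε) (2 * ε / Δ)
          (K₁ / 6) := by
  set B : ℝ := cd * (max 1 (ℓD : ℝ)) ^ d with hB
  set v : ℝ := cd * (max 1 (ℓ₀ : ℝ)) ^ d with hv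
  set g : ℝ := cd * 2 ^ d with hg
  have hB0 : 0 < B := by positivity
  have hv0 : 0 < v := by positivity
  have hg0 : 0 < g := by positivity
  have hE := Real.exp_pos B
  set m : ℝ := min (min 1 cd) (cd' / (32 * Real.exp B * v * g)) with hm
  have hm0 : 0 < m := by positivity
  have hm1 : m ≤ 1 := (min_le_left _ _).trans (min_le_left _ _)
  have hmcd : m ^ d ≤ cd :=
    (pow_le_of_le_one hm0.le hm1 (by omega)).trans ((min_le_left _ _).trans (min_le_right _ _))
  refine ⟨1, min (min (1 / 3) (1 / max 1 (ℓD : ℝ))) (1 / (32 * Real.exp B * (B + v))),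
    min (K₁ / 1440) (K₁ / 6 * m ^ d), one_pos, by positivity, by positivity, ?_⟩
  intro Λ _ _ G q ι _ _ C Δ R' δ ε ψ D V hG hV hiso hΔ hdiam hcoeff _ hψ hnd hD hDh hDr hDb hδ hDn
    hδΔ hVl hVh hVn hεΔ hR
  have := hG.nonempty
  replace hDn := normBound_of_localNorm_le hDn
  replace hVn := normBound_of_localNorm_le hVn
  have hε := hVn.nonneg
  set R : ℝ := 1 * Δ / δ with hRdef
  have hR0 : 0 < R := by positivity
  have hδ1 : δ ≤ 1 / max 1 (ℓD : ℝ) * Δ :=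
    hδΔ.trans (mul_le_mul_of_nonneg_right ((min_le_left _ _).trans (min_le_right _ _)) hΔ.le)
  have hδ2 : δ ≤ 1 / (32 * Real.exp B * (B + v)) * Δ :=
    hδΔ.trans (mul_le_mul_of_nonneg_right (min_le_right _ _) hΔ.le)
  have hε1 : 3 * ε ≤ Δ := by
    have := hεΔ.trans
      (mul_le_mul_of_nonneg_right ((min_le_left _ _).trans (min_le_left _ _)) hΔ.le)
    linarith
  have hR' : max 1 (ℓD : ℝ) ≤ R' := by
    refine le_trans ?_ hR.le
    rw [hRdef, one_mul, le_div_iff₀ hδ]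
    rwa [div_mul_eq_mul_div, one_mul, le_div_iff₀ (by positivity), mul_comm] at hδ1
  have hrM : (m * R) ^ d ≤ cd * R' ^ d := by
    rw [mul_pow]
    gcongr
  have hgap := gap_condition hB0.le hv0 hg0 hcd' hδ hΔ (min_le_right _ _ : m ≤ _) hδ2
  set k := optimalOrder (min (K₁ / 1440) (K₁ / 6 * m ^ d)) Δ ε R d with hk
  obtain ⟨hk1, hk2, hk3⟩ := optimalOrder_le (c := min (K₁ / 1440) (K₁ / 6 * m ^ d)) (d := d)
    (by positivity) hε hR0.le hε1
  rw [← hk] at hk1 hk2 hk3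
  obtain ⟨K, hK, hst⟩ := exists_stage (r := m * R) hd hcd hcd' hG hV hiso (by positivity) hΔ hdiam
    hcoeff hψ hnd hrM hD hDr hDn hDh hVl hVh hVn hK₁ hK₁' hε hgap k hk3 (by
      have := hk2.trans (mul_le_mul_of_nonneg_right (min_le_left _ _) hΔ.le)
      linarith)
  refine hst.locallyDiagonalizable (CommutingProjectors.hamiltonian_isHermitian.add hDh) hψ.1 ?_
    (by positivity) hK ?_ ?_
  · obtain ⟨c, hc⟩ := exists_total_mulVec_eq_smul_of_blockDiagonal hd hcd hcd' hG hV hiso hψ hnd hD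
      hDr hDb hR'
    exact ⟨c, by rw [Matrix.add_mulVec, CommutingProjectors.hamiltonian_mulVec hψ, hc, zero_add]⟩
  · have h1 : 0 ≤ ε * (1 / 4 : ℝ) ^ k := by positivity
    nlinarith
  · -- The terms on more than `(m R) ^ d` sites are smaller than the remainder, as `k` is at most
    -- of order `R ^ d`.
    have h1 : Real.exp (-(K₁ / 6 * (m * R) ^ d)) ≤ (1 / 2) ^ k := by
      have h2 : (k : ℝ) ≤ K₁ / 6 * (m * R) ^ d := by
        refine hk1.trans ?_
        rw [mul_pow, ← mul_assoc]
        gcongr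
        exact min_le_right _ _
      have h3 : ((1 : ℝ) / 2) ^ k = Real.exp (-(k * Real.log 2)) := by
        rw [Real.exp_neg, mul_comm, Real.exp_mul, Real.exp_log two_pos, Real.rpow_natCast, one_div,
          inv_pow]
      rw [h3, Real.exp_le_exp]
      have h4 : (k : ℝ) * Real.log 2 ≤ k * 1 := by
        have := Real.log_two_lt_d9
        gcongr
        linarith
      linarith
    have h5 : (2 : ℝ) ^ (2 - (k : ℝ)) = 4 * (1 / 2) ^ k := by
      rw [Real.rpow_sub two_pos, Real.rpow_natCast, one_div, inv_pow, ← div_eq_mul_inv]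
      norm_num
    have h6 : (1 / 4 : ℝ) ^ k ≤ (1 / 2) ^ k := by gcongr; norm_num
    have h7 : 8 / 3 * ε * (1 - (1 / 4 : ℝ) ^ k) ≤ 3 * ε := by
      have : 0 ≤ ε * (1 / 4 : ℝ) ^ k := by positivity
      linarith
    have h8 : (0 : ℝ) ≤ 1 - (1 / 4) ^ k := by
      have : (1 / 4 : ℝ) ^ k ≤ 1 := pow_le_one₀ (by norm_num) (by norm_num)
      linarith
    rw [h5]
    calc ε * (1 / 4) ^ k + Real.exp (-(K₁ / 6 * (m * R) ^ d)) * (8 / 3 * ε * (1 - (1 / 4) ^ k))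
        ≤ ε * (1 / 2) ^ k + (1 / 2) ^ k * (3 * ε) := by gcongr
      _ = ε * (4 * (1 / 2) ^ k) := by ring
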